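/- **Setting.** Let $\ell,\kappa,m:\mathbb N\to\mathbb N$ be polynomially bounded with $\kappa(\lambda)=\omega(\log\lambda)$, and put $n(\lambda)=\ell(\kappa(\lambda)+m(\lambda))$. In the length-$\ell$ common Haar function-like state (CHFS) model an independent Haar random $\ell(|x|)$-qubit pure state $|\phi_x\rangle$ is chosen for every $x\in\{0,1\}^*$; write $\Phi=(|\phi_x\rangle)_x$. All parties have access to one of the following oracles (for queries $x$ of any length $d$): the *isometry* oracle $\sum_{x\in\{0,1\}^d}|x\rangle\langle x|\otimes|\phi_x\rangle$, which appends a new $\ell(d)$-qubit register, or the *unitary* oracle $\sum_{x\in\{0,1\}^d}|x\rangle\langle x|\otimes S_x$, where $S_x$ acts on $\ell(d)+1$ qubits, swaps $|0^{\ell(d)+1}\rangle$ with $|\phi_x\rangle|1\rangle$, and is the identity on the orthogonal complement of these two vectors. Access is *quantum*, or *classical*, in which case the input register of every query to the CHFS oracle and to the generator (or its ideal counterpart) is measured in the computational basis before the query. Optionally, all parties also have quantum access to the $\mathbf{QPSPACE}$ oracle, which, controlled on a classical Turing machine $M$ and an integer $t$ (in binary), applies to a $w$-qubit register the $w$-qubit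 unitary circuit whose description $M$ outputs within $t$ steps, and flips a flag qubit if there is no such circuit. A *QPT oracle algorithm* is a family $(C_\lambda)_\lambda$ of oracle circuits (Hadamard, $T$ and CNOT gates, fresh qubits in state $|0\rangle$, and queries to the available oracles) such that one deterministic Turing machine, given $\lambda,n(\lambda),\kappa(\lambda),m(\lambda)$ in unary, outputs a description of $C_\lambda$ in time polynomial in $\lambda$. Relative to a fixed $\Phi$, a QPT oracle algorithm $\mathsf{Gen}$ is a *$(\kappa,m,n)$-PRFSG* if (i) for all $\lambda$, $k\in\{0,1\}^{\kappa(\lambda)}$ and $x\in\{0,1\}^{m(\lambda)}$, $\mathsf{Gen}_k$ on input $x$ keeps $x$ and outputs an $n(\lambda)$-qubit state in a new register, and (ii) for every QPT oracle adversary $\mathcal A$, with adaptive access to the oracles above and to one further oracle, there is a negligible function $\varepsilon$ such that for all $\lambda$ $$\left|\Pr_{k\leftarrow\{0,1\}^{\kappa(\lambda)}}\left[1\leftarrow\mathcal A_\lambda^{O^\Phi,\mathsf{Gen}_k}\right]-\Pr_{G}\left[1\leftarrow\mathcal A_\lambda^{O^\Phi,G}\right]\right|\le\varepsilon(\lambda),$$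 where $O^\Phi$ stands for the CHFS oracle (and $\mathbf{QPSPACE}$, if available), and $G:|x\rangle\mapsto|x\rangle|\psi_x\rangle$ for independent Haar random $n(\lambda)$-qubit states $|\psi_x\rangle$, $x\in\{0,1\}^{m(\lambda)}$. **Theorem.** For each choice of isometry or unitary CHFS oracle, of quantum or classical access, and with or without the $\mathbf{QPSPACE}$ oracle, there is a QPT oracle algorithm $\mathsf{Gen}$ that, with probability $1$ over $\Phi$, is a $(\kappa,m,n)$-PRFSG relative to $\Phi$, where $n(\lambda)=\ell(\kappa(\lambda)+m(\lambda))$. -/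

import Mathlib

open MeasureTheory Filter Asymptotics
open scoped ComplexConjugate

noncomputable section

namespace CHFS

/-! ### Classical Turing machines -/

/-- Tape symbols: blank (`none`) or a bit. -/
abbrev Sym := Option Bool

/-- A classical single-tape Turing machine, given by its finite transition table: an entry
`((q, a), (q', act))` says that in state `q`, reading `a`, the machine performs `act` (move the
head by one cell, or write a symbol) and enters state `q'`. The initial state is `0`; the machine
halts when no entry applies. -/
abbrev TM := List ((ℕ × Sym) × (ℕ × Turing.TM0.Stmt Sym))

def TM.machine (M : TM) : Turing.TM0.Machine Sym ℕ := fun q a => M.lookup (q, a)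

/-- On input `inp`, the machine `M` halts after at most `t` steps, and then the tape from the head
rightwards holds exactly the bit string `out` (followed by blanks). -/
def TM.OutputsWithin (M : TM) (inp : List Bool) (t : ℕ) (out : List Bool) : Prop :=
  ∃ (j : ℕ) (c : Turing.TM0.Cfg Sym ℕ), j ≤ t ∧
    (fun o => Option.bind o (Turing.TM0.step M.machine))^[j]
      (some (Turing.TM0.init (inp.map some) : Turing.TM0.Cfg Sym ℕ)) = some c ∧
    Turing.TM0.step M.machine c = none ∧
    c.Tape.right₀ = Turing.ListBlank.mk (out.map some)

/-- The number list `[n₁, n₂, …]` in unary notation: `1^{n₁} 0 1^{n₂} 0 …`. -/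
def unaryEncode : List ℕ → List Bool
  | [] => []
  | n :: l => List.replicate n true ++ false :: unaryEncode l

/-- The list of numbers denoted by a bit string (an unterminated last block is ignored). -/
def unaryDecode : List Bool → List ℕ
  | [] => []
  | false :: l => 0 :: unaryDecode l
  | true :: l =>
    match unaryDecode l with
    | [] => []
    | n :: r => (n + 1) :: r

def decodeSym : ℕ → Sym
  | 0 => none
  | 1 => some false
  | _ => some true

def decodeStmt : ℕ → Turing.TM0.Stmt Sym
  | 0 => .write none
  | 1 => .write (some false)
  | 2 => .write (some true)
  | 3 => .move .left
  | _ => .move .right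

/-- The Turing machine denoted by a list of numbers: every four numbers form a table entry. -/
def decodeTM : List ℕ → TM
  | q :: a :: q' :: b :: r => ((q, decodeSym a), (q', decodeStmt b)) :: decodeTM r
  | _ => []

/-- The number with binary digits `l`, least significant digit first. -/
def binaryValue : List Bool → ℕ
  | [] => 0
  | b :: l => b.toNat + 2 * binaryValue l

/-! ### Quantum oracle circuits -/

/-- A universal set of elementary gates; the arguments are wire numbers. -/
inductive Gate
  | had (i : ℕ)
  | t (i : ℕ)
  | cnot (i j : ℕ)

/-- Every wire that the gate touches is smaller than `w`. -/
def Gate.Within (w : ℕ) : Gate → Prop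
  | .had i => i < w
  | .t i => i < w
  | .cnot i j => i < w ∧ j < w

/-- Instructions of an oracle circuit. Oracles act on blocks of consecutive wires (other choices
of wires are reached by swapping wires with `cnot` gates).
* `alloc c` appends `c` new wires in state `|0⟩`;
* `chfs a d` queries the CHFS oracle for inputs of length `d`, with the input register on the wires
  `a, …, a + d - 1` (and, for the unitary oracle, the target register on the wires right after it);
* `qpspace a c₁ c₂ w` queries the QPSPACE oracle on consecutive registers, starting at wire `a`, for
  the machine (`c₁` wires), the running time (`c₂` wires), the quantum input (`w` wires) and the
  flag `⊥` (one wire);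
* `gen a` (for adversaries) queries the generator or the Haar random function-like state oracle,
  with the input register starting at wire `a`. -/
inductive Instr
  | gate (g : Gate)
  | alloc (c : ℕ)
  | chfs (a d : ℕ)
  | qpspace (a c₁ c₂ w : ℕ)
  | gen (a : ℕ)

abbrev Circuit := List Instr

/-- The circuit denoted by a list of numbers. -/
def decodeCircuit : List ℕ → Option Circuit
  | [] => some []
  | 0 :: c :: r => (decodeCircuit r).map (Instr.alloc c :: ·)
  | 1 :: i :: r => (decodeCircuit r).map (Instr.gate (.had i) :: ·)
  | 2 :: i :: r => (decodeCircuit r).map (Instr.gate (.t i) :: ·)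
  | 3 :: i :: j :: r => (decodeCircuit r).map (Instr.gate (.cnot i j) :: ·)
  | 4 :: a :: d :: r => (decodeCircuit r).map (Instr.chfs a d :: ·)
  | 5 :: a :: c₁ :: c₂ :: w :: r => (decodeCircuit r).map (Instr.qpspace a c₁ c₂ w :: ·)
  | 6 :: a :: r => (decodeCircuit r).map (Instr.gen a :: ·)
  | _ => none

def PolyBounded (f : ℕ → ℕ) : Prop :=
  ∃ p : Polynomial ℕ, ∀ s, f s ≤ p.eval s

/-- The family `C` of oracle circuits (indexed by the security parameter) is a QPT algorithm:
a single Turing machine, given the security parameter `s` and the length parameters in unary, writes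
down a description of `C s` in time polynomial in `s`. -/
def IsQPT (n κ m : ℕ → ℕ) (C : ℕ → Circuit) : Prop :=
  ∃ (M : TM) (p : Polynomial ℕ), ∀ s, ∃ out,
    M.OutputsWithin (unaryEncode [s, n s, κ s, m s]) (p.eval s) out ∧
    decodeCircuit (unaryDecode out) = some (C s)

/-! ### Haar random states and the CHFS randomness -/

/-- Pure `n`-qubit states: unit vectors in the `2^n`-dimensional complex Hilbert space. -/
abbrev PureState (n : ℕ) := Metric.sphere (0 : EuclideanSpace ℂ (Fin n → Bool)) 1

/-- The Haar distribution over pure `n`-qubit states: the normalized surface measure of the unit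
sphere. -/
def haarState (n : ℕ) : Measure (PureState n) :=
  ((volume : Measure (EuclideanSpace ℂ (Fin n → Bool))).toSphere Set.univ)⁻¹ •
    (volume : Measure (EuclideanSpace ℂ (Fin n → Bool))).toSphere

instance (n : ℕ) : IsProbabilityMeasure (haarState n) where
  measure_univ := by
    have h : (volume : Measure (EuclideanSpace ℂ (Fin n → Bool))).toSphere ≠ 0 :=
      Measure.toSphere_ne_zero _
    simp only [haarState, Measure.smul_apply, smul_eq_mul]
    exact ENNReal.inv_mul_cancel (fun h0 => h (Measure.measure_univ_eq_zero.1 h0))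
      (measure_ne_top _ _)

/-- A choice of a pure `ℓ(|x|)`-qubit state for every bit string `x`. -/
abbrev StateFamily (ℓ : ℕ → ℕ) := (x : List Bool) → PureState (ℓ x.length)

/-- The randomness of the length-`ℓ` CHFS model: independent Haar random states. -/
def chfsMeasure (ℓ : ℕ → ℕ) : Measure (StateFamily ℓ) :=
  Measure.infinitePi fun x : List Bool => haarState (ℓ x.length)

/-! ### Execution of oracle circuits -/

/-- Isometry oracle `|x⟩ ↦ |x⟩|φ_x⟩` or unitarized (reflection) oracle. -/
inductive Model
  | isometry
  | unitary

/-- Whether input registers of queries are measured before the query. -/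
inductive Access
  | quantum
  | classical

structure Setting where
  model : Model
  access : Access
  /-- whether the QPSPACE oracle is available -/
  qpspace : Bool

/-- Computational basis states `|s⟩|e⟩`: `s` lists the values of the wires of the algorithm, and
`e` the values of registers that were discarded (traced out) or that record measurement outcomes;
the latter cannot be accessed any more. -/
abbrev Basis := List Bool × List (List Bool)

/-- Pure states of the wires together with the inaccessible environment. -/
abbrev QState := Basis →₀ ℂ

def ket (s : List Bool) (e : List (List Bool)) : QState := Finsupp.single (s, e) 1

/-- The value of the wires `a, …, a + d - 1`. -/
def block (s : List Bool) (a d : ℕ) : List Bool := (s.drop a).take d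

/-- The elementary gates, with all wire numbers shifted by `o`. Gates on missing wires do
nothing. -/
def Gate.op (o : ℕ) : Gate → Basis → QState
  | .had i, (s, e) =>
    if o + i < s.length then
      ((1 / √2 : ℝ) : ℂ) • (ket (s.set (o + i) false) e +
        (if s.getD (o + i) false then (-1 : ℂ) else 1) • ket (s.set (o + i) true) e)
    else ket s e
  | .t i, (s, e) =>
    (if s.getD (o + i) false then Complex.exp (Complex.I * (Real.pi / 4 : ℝ)) else 1) • ket s e
  | .cnot i j, (s, e) =>
    if i ≠ j ∧ o + i < s.length ∧ o + j < s.length ∧ s.getD (o + i) false then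
      ket (s.set (o + j) (!s.getD (o + j) false)) e
    else ket s e

/-- The linear extension of an operation given on basis states. -/
def applyOp (f : Basis → QState) (ψ : QState) : QState := Finsupp.linearCombination ℂ f ψ

def runGates (o : ℕ) (C : List Gate) (ψ : QState) : QState :=
  C.foldl (fun ψ g => applyOp (g.op o) ψ) ψ

/-- The machine `M` terminates within `t` steps (on the empty tape), and its output describes the
unitary circuit `C` on `w` qubits. -/
def DescribesUnitary (M : TM) (t w : ℕ) (C : List Gate) : Prop :=
  (∃ out, M.OutputsWithin [] t out ∧
    decodeCircuit (unaryDecode out) = some (C.map Instr.gate)) ∧ ∀ g ∈ C, g.Within w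

open Classical in
/-- The QPSPACE oracle: controlled on the machine `M` and the time `t` (in binary), it applies the
circuit that `M` outputs within `t` steps; it flips the flag wire if there is no such circuit. -/
def qpspaceOp (a c₁ c₂ w : ℕ) : Basis → QState := fun (s, e) =>
  if a + c₁ + c₂ + w + 1 ≤ s.length then
    let M := decodeTM (unaryDecode (block s a c₁))
    let t := binaryValue (block s (a + c₁) c₂)
    let o := a + c₁ + c₂
    if h : ∃ C, DescribesUnitary M t w C then runGates o h.choose (ket s e)
    else ket (s.set (o + w) (!s.getD (o + w) false)) e
  else ket s e

/-- For classical access the value of the input register is measured: the environment keeps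
a copy of it. -/
def Access.record (acc : Access) (x : List Bool) (e : List (List Bool)) : List (List Bool) :=
  match acc with
  | .quantum => e
  | .classical => x :: e

/-- The isometry CHFS oracle `∑ₓ |x⟩⟨x| ⊗ |φ_x⟩`, appending a new register. -/
def isometryOp {ℓ : ℕ → ℕ} (Φ : StateFamily ℓ) (acc : Access) (a d : ℕ) : Basis → QState :=
  fun (s, e) =>
    if a + d ≤ s.length then
      let x := block s a d
      ∑ y : Fin (ℓ x.length) → Bool, (Φ x).1 y • ket (s ++ List.ofFn y) (acc.record x e)
    else ket s e

/-- Amplitudes of `|φ-⟩ = (|0^{n+1}⟩ - |φ⟩|1⟩) / √2`. -/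
def minusVec {n : ℕ} (φ : PureState n) (z : Fin (n + 1) → Bool) : ℂ :=
  ((1 / √2 : ℝ) : ℂ) * ((if z = fun _ => false then 1 else 0) -
    (if z (Fin.last n) then φ.1 (fun i => z i.castSucc) else 0))

/-- The entry `⟨z|S|y⟩` of the reflection `S = I - 2|φ-⟩⟨φ-|`, which swaps `|0^{n+1}⟩` and
`|φ⟩|1⟩`. -/
def swapEntry {n : ℕ} (φ : PureState n) (z y : Fin (n + 1) → Bool) : ℂ :=
  (if z = y then 1 else 0) - 2 * minusVec φ z * conj (minusVec φ y)

/-- The unitarized CHFS oracle `∑ₓ |x⟩⟨x| ⊗ S_{|φ_x⟩|1⟩}`; its target register consists of the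
`ℓ(d) + 1` wires after the input register. -/
def unitaryOp {ℓ : ℕ → ℕ} (Φ : StateFamily ℓ) (acc : Access) (a d : ℕ) : Basis → QState :=
  fun (s, e) =>
    if a + d + (ℓ d + 1) ≤ s.length then
      let x := block s a d
      let y : Fin (ℓ x.length + 1) → Bool := fun i => s.getD (a + d + i) false
      ∑ z : Fin (ℓ x.length + 1) → Bool, swapEntry (Φ x) z y •
        ket (s.take (a + d) ++ List.ofFn z ++ s.drop (a + d + (ℓ x.length + 1)))
          (acc.record x e)
    else ket s e

/-- The effect of one instruction, where `G a` is the effect of `gen a`. -/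
def Instr.op {ℓ : ℕ → ℕ} (S : Setting) (Φ : StateFamily ℓ) (G : ℕ → Basis → QState) :
    Instr → Basis → QState
  | .gate g => g.op 0
  | .alloc c => fun (s, e) => ket (s ++ List.replicate c false) e
  | .chfs a d =>
    match S.model with
    | .isometry => isometryOp Φ S.access a d
    | .unitary => unitaryOp Φ S.access a d
  | .qpspace a c₁ c₂ w => if S.qpspace then qpspaceOp a c₁ c₂ w else fun (s, e) => ket s e
  | .gen a => G a

def run {ℓ : ℕ → ℕ} (S : Setting) (Φ : StateFamily ℓ) (G : ℕ → Basis → QState)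
    (C : Circuit) (ψ : QState) : QState :=
  C.foldl (fun ψ I => applyOp (I.op S Φ G) ψ) ψ

/-- The probability that a measurement of the first wire yields `1`. -/
def acceptProb (ψ : QState) : ℝ :=
  ψ.sum fun b c => if b.1.head? = some true then ‖c‖ ^ 2 else 0

/-! ### Pseudorandom function-like state generators -/

/-- The final state of the generator circuit `C` with key `k` and input `x`: the first wires hold
the key, the next ones the input. (A generator has no oracle `gen`.) -/
def runGen {ℓ : ℕ → ℕ} (S : Setting) (Φ : StateFamily ℓ) (C : Circuit) (k x : List Bool)
    (e : List (List Bool)) : QState :=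
  run S Φ (fun _ (s, e) => ket s e) C (ket (k ++ x) e)

/-- The generator maps `|k⟩|x⟩` to a state on the key register, the unchanged input `|x⟩`, a new
`n`-qubit output register, and possibly further wires. -/
def GeneratesStates {ℓ : ℕ → ℕ} (S : Setting) (Φ : StateFamily ℓ) (κ m n : ℕ) (C : Circuit) :
    Prop :=
  ∀ k x : List Bool, k.length = κ → x.length = m →
    ∀ b ∈ (runGen S Φ C k x []).support,
      κ + m + n ≤ b.1.length ∧ block b.1 κ m = x

/-- Oracle access to the generator with key `k`: the output register is appended to the wires of
the caller, everything else but the input register is discarded. -/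
def genOracle {ℓ : ℕ → ℕ} (S : Setting) (Φ : StateFamily ℓ) (m n : ℕ) (C : Circuit)
    (k : List Bool) (a : ℕ) : Basis → QState := fun (s, e) =>
  if a + m ≤ s.length then
    let x := block s a m
    (runGen S Φ C k x (S.access.record x e)).mapDomain fun (t, e') =>
      (s ++ block t (k.length + m) n,
        t.take k.length :: t.drop (k.length + m + n) :: e')
  else ket s e

/-- Oracle access to `|x⟩ ↦ |x⟩|ψ_x⟩`. -/
def haarOracle (acc : Access) (m n : ℕ) (Ψ : (Fin m → Bool) → PureState n) (a : ℕ) :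
    Basis → QState := fun (s, e) =>
  if a + m ≤ s.length then
    ∑ y : Fin n → Bool, (Ψ fun i => s.getD (a + i) false).1 y •
      ket (s ++ List.ofFn y) (acc.record (block s a m) e)
  else ket s e

/-- The probability, over the uniform key `k`, that the adversary circuit `A` with access to the
oracles and to the generator outputs `1`. -/
def realProb {ℓ : ℕ → ℕ} (S : Setting) (Φ : StateFamily ℓ) (κ m n : ℕ) (C A : Circuit) : ℝ :=
  (∑ k : Fin κ → Bool,
    acceptProb (run S Φ (genOracle S Φ m n C (List.ofFn k)) A (ket [] []))) / 2 ^ κ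

/-- The probability, over independent Haar random states `ψ_x`, that the adversary circuit `A` with
access to the oracles and to `|x⟩ ↦ |x⟩|ψ_x⟩` outputs `1`. -/
def idealProb {ℓ : ℕ → ℕ} (S : Setting) (Φ : StateFamily ℓ) (m n : ℕ) (A : Circuit) : ℝ :=
  ∫ Ψ, acceptProb (run S Φ (haarOracle S.access m n Ψ) A (ket [] []))
    ∂(Measure.pi fun _ : Fin m → Bool => haarState n)

def Negligible (ε : ℕ → ℝ) : Prop :=
  SuperpolynomialDecay atTop (fun s : ℕ => (s : ℝ)) ε

/-- Relative to the CHFS oracle with randomness `Φ`, the QPT algorithm `Gen` is an adaptively secure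
pseudorandom function-like state generator with key length `κ`, input length `m` and output length
`n`. -/
structure IsPRFSG {ℓ : ℕ → ℕ} (S : Setting) (Φ : StateFamily ℓ) (κ m n : ℕ → ℕ)
    (Gen : ℕ → Circuit) : Prop where
  isQPT : IsQPT n κ m Gen
  stateGeneration : ∀ s, GeneratesStates S Φ (κ s) (m s) (n s) (Gen s)
  pseudorandomness : ∀ A : ℕ → Circuit, IsQPT n κ m A →
    ∃ ε : ℕ → ℝ, Negligible ε ∧ ∀ s,
      |realProb S Φ (κ s) (m s) (n s) (Gen s) (A s) - idealProb S Φ (m s) (n s) (A s)| ≤ ε s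

end CHFS

end

open scoped ComplexConjugate InnerProductSpace

noncomputable section

namespace CHFS

/-! ### Turing machines: step-by-step execution -/

/-! The generator queries the CHFS oracle on `k ‖ x`. The registers it discards hold data determined
by `k`, `x` and the security parameter, so up to an injective relabelling of the environment it is
the ideal oracle for the states `keyBlock k Φ` (`run_genOracle`, `realProb_prfsGen`). Let `g(Φ, Ψ)`
be the acceptance probability of an adversary circuit with CHFS states `Φ` and ideal oracle states
`Ψ` (`haarAccept`). The advantage is then `D(Φ) = avg_k g(Φ, keyBlock k Φ) - ∫ g(Φ, Ψ) dΨ`.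

The second moment of `D` over `Φ` is small (`integral_sq_average_sub_le`). Write `E[D²] = avg_k
E[u_k D]` with `u_k(Φ) = g(Φ, keyBlock k Φ) - ∫ g(Φ, Ψ) dΨ`. Replacing block `k` of `Φ` by fresh
states `Ψ` preserves the distribution (`measurePreserving_reprogram`). It turns `u_k` into something
close to `g(Φ, Ψ) - ∫ g(Φ, ·)`, which has mean zero given `Φ`, and it hardly moves `D`. Hence `E[u_k
D]` is close to zero for most `k`.

"Close" is the hybrid argument for quantum search: `q` instructions cannot notice, on average over
`k`, that one of `2^κ` disjoint blocks was replaced. The total change over all keys is at most `4 q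
√(2^κ)` (`sum_abs_haarAccept_sub_le`). It relies on every instruction being an isometry
(`Instr.isoOn`); the kind of oracle, the kind of access and QPSPACE matter only there and in the
relabelling.

So `E[D²]` is at most a polynomial times `2^{-κ/2}`, which is negligible because `κ` is
superlogarithmic. Summing second moments with polynomial weights makes the advantage of a fixed
adversary negligible almost surely (`ae_superpolynomialDecay`). There are only countably many QPT
adversaries (`countable_setOf_isQPT`), so one null set serves all of them. The Turing machine part
shows that the generator is uniform and that adversary circuits have polynomial length. -/

open Turing in
/-- After exactly `j` steps the machine `M` passes from `c` to `c'`. -/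
def TM.Runs (M : TM) (j : ℕ) (c c' : TM0.Cfg Sym ℕ) : Prop :=
  (fun o => Option.bind o (TM0.step M.machine))^[j] (some c) = some c'

/-- The configuration in state `q` with `L` on the left of the head, and `R` from the head
rightwards. -/
def cfg (q : ℕ) (L R : Turing.ListBlank Sym) : Turing.TM0.Cfg Sym ℕ := ⟨q, Turing.Tape.mk' L R⟩

/-- `j` ones in front of `L`. -/
def ones (j : ℕ) (L : Turing.ListBlank Sym) : Turing.ListBlank Sym :=
  (Turing.ListBlank.cons (some true))^[j] L

theorem ones_succ (j : ℕ) (L : Turing.ListBlank Sym) :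
    ones (j + 1) L = (ones j L).cons (some true) :=
  Function.iterate_succ_apply' _ _ _

theorem ones_succ' (j : ℕ) (L : Turing.ListBlank Sym) :
    ones (j + 1) L = ones j (L.cons (some true)) :=
  Function.iterate_succ_apply _ _ _

theorem ones_ones (i j : ℕ) (L : Turing.ListBlank Sym) : ones i (ones j L) = ones (i + j) L :=
  (Function.iterate_add_apply _ _ _ _).symm

namespace TM.Runs

open Turing

variable {M : TM} {q q' : ℕ} {a b : Sym} {L R : ListBlank Sym}

theorem trans {i j : ℕ} {c₁ c₂ c₃ : TM0.Cfg Sym ℕ} (h₁ : M.Runs i c₁ c₂) (h₂ : M.Runs j c₂ c₃) :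
    M.Runs (i + j) c₁ c₃ := by
  unfold TM.Runs at *
  rw [add_comm, Function.iterate_add_apply, h₁, h₂]

theorem move_right (h : M.lookup (q, a) = some (q', .move .right)) :
    M.Runs 1 (cfg q L (R.cons a)) (cfg q' (L.cons a) R) := by
  simp [TM.Runs, cfg, TM0.step, TM.machine, h]

theorem move_left (h : M.lookup (q, a) = some (q', .move .left)) :
    M.Runs 1 (cfg q L (R.cons a)) (cfg q' L.tail ((R.cons a).cons L.head)) := by
  simp [TM.Runs, cfg, TM0.step, TM.machine, h]

theorem write (h : M.lookup (q, a) = some (q', .write b)) :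
    M.Runs 1 (cfg q L (R.cons a)) (cfg q' L (R.cons b)) := by
  simp [TM.Runs, cfg, TM0.step, TM.machine, h]

theorem scan_right (h : M.lookup (q, some true) = some (q, .move .right)) (j : ℕ) :
    M.Runs j (cfg q L (ones j R)) (cfg q (ones j L) R) := by
  induction j generalizing L with
  | zero => rfl
  | succ j ih =>
    rw [ones_succ, ones_succ', add_comm]
    exact (move_right h).trans ih

/-- The first step has its own hypothesis because it may start in another state and on another
symbol. All later steps are the case `q = q'`, `a = 1`, which is why the induction varies `q`, `a`
and `R`. -/
theorem scan_left (h₀ : M.lookup (q, a) = some (q', .move .left))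
    (h : M.lookup (q', some true) = some (q', .move .left)) (j : ℕ) :
    M.Runs (j + 1) (cfg q (ones j (L.cons b)) (R.cons a))
      (cfg q' L ((ones j (R.cons a)).cons b)) := by
  induction j generalizing q a R with
  | zero => simpa [ones] using move_left (L := L.cons b) (R := R) h₀
  | succ j ih =>
    have h1 := move_left (L := ones (j + 1) (L.cons b)) (R := R) h₀
    rw [ones_succ, ListBlank.tail_cons, ListBlank.head_cons] at h1
    rw [ones_succ, ones_succ', add_comm (j + 1)]
    exact h1.trans (ih h)

theorem outputsWithin {j t : ℕ} {inp out : List Bool} {I O : ListBlank Sym}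
    (h : M.Runs j (cfg 0 (ListBlank.mk []) I) (cfg q L O)) (hj : j ≤ t)
    (hI : ListBlank.mk (inp.map some) = I) (hO : ListBlank.mk (out.map some) = O)
    (hh : M.lookup (q, O.head) = none) : M.OutputsWithin inp t out := by
  subst hI hO
  exact ⟨j, _, hj, h, by simpa [cfg, TM0.step, TM.machine] using hh, by simp [cfg]⟩

end TM.Runs

theorem mk_unaryEncode_cons (n : ℕ) (l : List ℕ) :
    Turing.ListBlank.mk ((unaryEncode (n :: l)).map some) =
      ones n ((Turing.ListBlank.mk ((unaryEncode l).map some)).cons (some false)) := by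
  induction n with
  | zero => simp [unaryEncode, ones]
  | succ n ih =>
    rw [ones_succ, ← ih]
    simp [unaryEncode, List.replicate_succ]

theorem unaryDecode_unaryEncode (l : List ℕ) : unaryDecode (unaryEncode l) = l := by
  induction l with
  | nil => rfl
  | cons n l ih =>
    simp only [unaryEncode]
    induction n with
    | zero => simp [unaryDecode, ih]
    | succ n ihn => simp [List.replicate_succ, unaryDecode, ihn]

theorem mk_blank : (Turing.ListBlank.mk ([] : List Sym)).cons none = Turing.ListBlank.mk [] := by
  exact Turing.ListBlank.cons_head_tail (Turing.ListBlank.mk ([] : List Sym))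

/-! ### The machines that write down the generator -/

/-- Rewrites `1^s 0 1^n 0 1^κ 0 1^m 0` as `1111 0 0 1^{κ+m} 0`. -/
def isometryGenTM : TM :=
  [((0, some true), (0, .move .right)), ((0, some false), (1, .move .right)),
   ((1, some true), (1, .move .right)), ((1, some false), (2, .move .right)),
   ((2, some true), (2, .move .right)), ((2, some false), (3, .write (some true))),
   ((3, some true), (3, .move .right)), ((3, some false), (4, .write none)),
   ((4, none), (5, .move .left)), ((5, some true), (6, .write (some false))),
   ((6, some false), (7, .move .left)),
   ((7, some true), (7, .move .left)), ((7, some false), (8, .move .left)),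
   ((8, none), (9, .write (some false))), ((8, some false), (9, .write (some false))),
   ((8, some true), (9, .write (some false))), ((9, some false), (10, .move .left)),
   ((10, none), (11, .write (some true))), ((10, some false), (11, .write (some true))),
   ((10, some true), (11, .write (some true))), ((11, some true), (12, .move .left)),
   ((12, none), (13, .write (some true))), ((12, some false), (13, .write (some true))),
   ((12, some true), (13, .write (some true))), ((13, some true), (14, .move .left)),
   ((14, none), (15, .write (some true))), ((14, some false), (15, .write (some true))),
   ((14, some true), (15, .write (some true))), ((15, some true), (16, .move .left)),
   ((16, none), (17, .write (some true))), ((16, some false), (17, .write (some true))),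
   ((16, some true), (17, .write (some true)))]

/-- Turning the separator between `1^κ` and `1^m` into a one adds the two numbers in unary. The
prefix is written over cells to the left of the sum, and whatever lies left of the final head
position is not part of the output. -/
theorem isometryGenTM_outputsWithin (s n κ m : ℕ) :
    isometryGenTM.OutputsWithin (unaryEncode [s, n, κ, m]) (s + n + 2 * κ + 2 * m + 30)
      (unaryEncode [4, 0, κ + m]) := by
  have e : ones m ((ones κ (((ones n ((ones s (Turing.ListBlank.mk [])).cons
      (some false)))).cons (some false))).cons (some true)) =
      (ones (m + κ) (((ones n ((ones s (Turing.ListBlank.mk [])).cons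
      (some false)))).cons (some false))).cons (some true) := by
    rw [← ones_succ, ← ones_succ, ones_ones, add_assoc]
  have h := (((((((TM.Runs.scan_right (M := isometryGenTM) (q := 0)
      (L := Turing.ListBlank.mk [])
      (R := (ones n ((ones κ ((ones m ((Turing.ListBlank.mk []).cons (some false))).cons
        (some false))).cons (some false))).cons (some false)) rfl s).trans
    (TM.Runs.move_right (q' := 1) rfl)).trans (TM.Runs.scan_right rfl n)).trans
    (TM.Runs.move_right (q' := 2) rfl)).trans (TM.Runs.scan_right rfl κ)).trans
    (TM.Runs.write (q' := 3) (b := some true) rfl)).trans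
    (TM.Runs.move_right (q' := 3) rfl)).trans (TM.Runs.scan_right rfl m)
  have h := ((h.trans (TM.Runs.write (q' := 4) (b := none) rfl)).trans
    (TM.Runs.move_left (q' := 5) rfl))
  rw [e, Turing.ListBlank.tail_cons, Turing.ListBlank.head_cons] at h
  have h := ((h.trans (TM.Runs.write (q' := 6) (b := some false) rfl)).trans
    (TM.Runs.scan_left (q' := 7) rfl rfl (m + κ))).trans (TM.Runs.move_left (q' := 8) rfl)
  -- The five cells overwritten from here on may be ones, separators or blanks, depending on how
  -- small `s` and `n` are, so these states must accept every symbol.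
  have h8 : ∀ a, isometryGenTM.lookup (8, a) = some (9, .write (some false)) := by
    rintro (_ | _ | _) <;> rfl
  have h10 : ∀ a, isometryGenTM.lookup (10, a) = some (11, .write (some true)) := by
    rintro (_ | _ | _) <;> rfl
  have h12 : ∀ a, isometryGenTM.lookup (12, a) = some (13, .write (some true)) := by
    rintro (_ | _ | _) <;> rfl
  have h14 : ∀ a, isometryGenTM.lookup (14, a) = some (15, .write (some true)) := by
    rintro (_ | _ | _) <;> rfl
  have h16 : ∀ a, isometryGenTM.lookup (16, a) = some (17, .write (some true)) := by
    rintro (_ | _ | _) <;> rfl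
  have h := ((((((((h.trans (TM.Runs.write (h8 _))).trans
    (TM.Runs.move_left (q' := 10) rfl)).trans
    (TM.Runs.write (h10 _))).trans (TM.Runs.move_left (q' := 12) rfl)).trans
    (TM.Runs.write (h12 _))).trans (TM.Runs.move_left (q' := 14) rfl)).trans
    (TM.Runs.write (h14 _))).trans (TM.Runs.move_left (q' := 16) rfl)).trans
    (TM.Runs.write (h16 _))
  rw [mk_blank, add_comm m κ] at h
  refine TM.Runs.outputsWithin h (by omega) ?_ ?_ rfl
  · simp only [mk_unaryEncode_cons]; rfl
  · simp only [mk_unaryEncode_cons]; rfl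

/-- Rewrites `1^s 0 1^n 0 1^κ 0 1^m 0` as `0 1^{s+1+n} 0 1111 0 0 1^{κ+m} 0`. -/
def unitaryGenTM : TM :=
  [((0, some true), (0, .move .right)), ((0, some false), (1, .write (some true))),
   ((1, some true), (1, .move .right)), ((1, some false), (2, .move .right)),
   ((2, some true), (2, .move .right)), ((2, some false), (3, .write (some true))),
   ((3, some true), (3, .move .right)), ((3, some false), (4, .write (some true))),
   ((4, some true), (5, .move .right)), ((5, none), (6, .write (some true))),
   ((6, some true), (7, .move .right)), ((7, none), (8, .write (some true))),
   ((8, some true), (9, .move .right)), ((9, none), (10, .write (some true))),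
   ((10, some true), (11, .move .right)), ((11, none), (12, .write (some true))),
   ((12, some true), (13, .move .right)), ((13, none), (14, .write (some false))),
   ((14, some false), (15, .move .left)),
   ((15, some true), (15, .move .left)), ((15, some false), (16, .move .right)),
   ((16, some true), (17, .move .right)), ((17, some true), (18, .move .right)),
   ((18, some true), (19, .move .right)), ((19, some true), (20, .move .right)),
   ((20, some true), (21, .write (some false))), ((21, some false), (22, .move .right)),
   ((22, some true), (23, .write (some false))), ((23, some false), (24, .move .left)),
   ((24, some false), (25, .move .left)),
   ((25, some true), (25, .move .left)), ((25, some false), (26, .move .left)),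
   ((26, some true), (26, .move .left)), ((26, none), (27, .write (some false)))]

/-- Allocating `s + 1 + n` wires instead of the necessary `n + 1` lets the machine keep `1^s` and
`1^n` in place and merely fill the separator between them. The `s` superfluous wires become garbage
of the generator. -/
theorem unitaryGenTM_outputsWithin (s n κ m : ℕ) :
    unitaryGenTM.OutputsWithin (unaryEncode [s, n, κ, m]) (2 * s + 2 * n + 2 * κ + 2 * m + 100)
      (unaryEncode [0, s + 1 + n, 4, 0, κ + m]) := by
  have h := ((((((((TM.Runs.scan_right (M := unitaryGenTM) (q := 0)
      (L := Turing.ListBlank.mk [])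
      (R := (ones n ((ones κ ((ones m ((Turing.ListBlank.mk []).cons (some false))).cons
        (some false))).cons (some false))).cons (some false)) rfl s).trans
    (TM.Runs.write (q' := 1) (b := some true) rfl)).trans
    (TM.Runs.move_right (q' := 1) rfl)).trans (TM.Runs.scan_right rfl n)).trans
    (TM.Runs.move_right (q' := 2) rfl)).trans (TM.Runs.scan_right rfl κ)).trans
    (TM.Runs.write (q' := 3) (b := some true) rfl)).trans
    (TM.Runs.move_right (q' := 3) rfl)).trans (TM.Runs.scan_right rfl m)
  have h := (h.trans (TM.Runs.write (q' := 4) (b := some true) rfl)).trans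
    (TM.Runs.move_right (q' := 5) rfl)
  have h : ∃ i ≤ s + n + κ + m + 30, unitaryGenTM.Runs i _ _ := ⟨_, by omega, h⟩
  have step : ∀ (q : ℕ) {c : Turing.TM0.Cfg Sym ℕ} {L : Turing.ListBlank Sym} {j : ℕ},
      unitaryGenTM.lookup (q, none) = some (q + 1, .write (some true)) →
      unitaryGenTM.lookup (q + 1, some true) = some (q + 2, .move .right) →
      unitaryGenTM.Runs j c (cfg q L (Turing.ListBlank.mk [])) →
      unitaryGenTM.Runs (j + 2) c (cfg (q + 2) (L.cons (some true)) (Turing.ListBlank.mk [])) := by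
    intro q c L j h1 h2 h
    rw [← mk_blank] at h
    exact (h.trans (TM.Runs.write h1)).trans (TM.Runs.move_right h2)
  obtain ⟨i, hi, h⟩ := h
  have h := step 11 rfl rfl (step 9 rfl rfl (step 7 rfl rfl (step 5 rfl rfl h)))
  rw [← mk_blank] at h
  have h := h.trans (TM.Runs.write (q' := 14) (b := some false) rfl)
  simp only [← ones_succ, ones_ones] at h
  have h := ((h.trans (TM.Runs.scan_left (q' := 15) rfl rfl _)).trans
    (TM.Runs.move_right (q' := 16) rfl))
  -- Two filled separators and four appended ones leave six ones beyond `κ + m`, exactly the room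
  -- for `1111 0 0`.
  rw [show m + (κ + 1) + 1 + 1 + 1 + 1 + 1 = (κ + m) + 1 + 1 + 1 + 1 + 1 + 1 by omega] at h
  rw [ones_succ, ones_succ, ones_succ, ones_succ, ones_succ, ones_succ] at h
  have h := ((((((((h.trans (TM.Runs.move_right (q' := 17) rfl)).trans
    (TM.Runs.move_right (q' := 18) rfl)).trans (TM.Runs.move_right (q' := 19) rfl)).trans
    (TM.Runs.move_right (q' := 20) rfl)).trans
    (TM.Runs.write (q' := 21) (b := some false) rfl)).trans
    (TM.Runs.move_right (q' := 22) rfl)).trans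
    (TM.Runs.write (q' := 23) (b := some false) rfl)).trans
    (TM.Runs.move_left (q' := 24) rfl))
  rw [Turing.ListBlank.tail_cons, Turing.ListBlank.head_cons] at h
  have h := (((h.trans (TM.Runs.scan_left (q' := 25) rfl rfl 4)).trans
    (TM.Runs.scan_left (q' := 26) rfl rfl (n + (s + 1)))).trans
    (TM.Runs.write (q' := 27) (b := some false) rfl))
  rw [mk_blank] at h
  refine TM.Runs.outputsWithin h (by omega) ?_ ?_ rfl
  · simp only [mk_unaryEncode_cons]; rfl
  · simp only [mk_unaryEncode_cons, show s + 1 + n = n + (s + 1) by omega]; rfl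

/-! ### Outputs of Turing machines -/

theorem iterate_bind_none {α : Type*} (f : α → Option α) (j : ℕ) :
    (fun o => Option.bind o f)^[j] none = none := by
  induction j with
  | zero => rfl
  | succ j ih => rw [Function.iterate_succ_apply', ih]; rfl

theorem iterate_bind_halt_unique {α : Type*} {f : α → Option α} {o : Option α} {i j : ℕ} {c d : α}
    (hi : (fun o => Option.bind o f)^[i] o = some c) (hc : f c = none)
    (hj : (fun o => Option.bind o f)^[j] o = some d) : j ≤ i := by
  by_contra! h
  obtain ⟨k, rfl⟩ := Nat.exists_eq_add_of_lt h
  rw [show i + k + 1 = k + (1 + i) by omega, Function.iterate_add_apply, Function.iterate_add_apply,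
    hi] at hj
  simp [hc, iterate_bind_none] at hj

theorem listBlank_mk_some_injective {l l' : List Bool}
    (h : (Turing.ListBlank.mk (l.map some) : Turing.ListBlank Sym) =
      Turing.ListBlank.mk (l'.map some)) : l = l' := by
  induction l generalizing l' with
  | nil =>
    cases l' with
    | nil => rfl
    | cons b l' => simpa using congrArg Turing.ListBlank.head h
  | cons a l ih =>
    cases l' with
    | nil => simpa using congrArg Turing.ListBlank.head h
    | cons b l' =>
      have h1 := congrArg Turing.ListBlank.head h
      have h2 := congrArg Turing.ListBlank.tail h
      simp only [List.map_cons, Turing.ListBlank.head_mk, Turing.ListBlank.tail_mk, List.headI_cons,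
        List.tail_cons, Option.some.injEq] at h1 h2
      rw [h1, ih h2]

/-- A halted configuration has no successor, so two halting runs have the same length. The time
bounds may differ, so a circuit family is determined by its machine alone, without its polynomial.
-/
theorem TM.OutputsWithin.unique {M : TM} {inp out out' : List Bool} {t t' : ℕ}
    (h : M.OutputsWithin inp t out) (h' : M.OutputsWithin inp t' out') : out = out' := by
  obtain ⟨j, c, -, hc, hh, ho⟩ := h
  obtain ⟨j', c', -, hc', hh', ho'⟩ := h'
  obtain rfl : j = j' := le_antisymm (iterate_bind_halt_unique hc' hh' hc)
    (iterate_bind_halt_unique hc hh hc')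
  obtain rfl : c = c' := Option.some.inj (hc.symm.trans hc')
  exact listBlank_mk_some_injective (ho.symm.trans ho')

/-- Cells are numbered relative to the head, which moves at most one cell per step and writes only
at position zero. Hence the blank region on the right recedes by at most one position per step. -/
theorem TM.nth_eq_none_of_runs {M : TM} {c c' : Turing.TM0.Cfg Sym ℕ} {N : ℕ}
    (hc : ∀ i : ℤ, N ≤ i → c.Tape.nth i = none) (j : ℕ) (h : M.Runs j c c') :
    ∀ i : ℤ, N + j ≤ i → c'.Tape.nth i = none := by
  induction j generalizing c' with
  | zero =>
    obtain rfl : c = c' := by simpa [TM.Runs] using h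
    simpa using hc
  | succ j ih =>
    unfold TM.Runs at h
    rw [Function.iterate_succ_apply'] at h
    obtain ⟨d, hd, hs⟩ := Option.bind_eq_some_iff.1 h
    intro i hi
    push_cast at hi
    simp only [Turing.TM0.step, Option.map_eq_some_iff] at hs
    obtain ⟨⟨q, a⟩, -, rfl⟩ := hs
    rcases a with (_ | _) | b
    · simp only [Turing.Tape.move_left_nth]
      exact ih hd _ (by omega)
    · simp only [Turing.Tape.move_right_nth]
      exact ih hd _ (by omega)
    · simp only [Turing.Tape.write_nth]
      rw [if_neg (by omega)]
      exact ih hd _ (by omega)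

theorem TM.OutputsWithin.length_le {M : TM} {inp out : List Bool} {t : ℕ}
    (h : M.OutputsWithin inp t out) : out.length ≤ inp.length + t := by
  obtain ⟨j, c, hj, hc, -, ho⟩ := h
  by_contra! hlt
  have h0 : ∀ i : ℤ, (inp.length : ℕ) ≤ i →
      (Turing.TM0.init (inp.map some) : Turing.TM0.Cfg Sym ℕ).Tape.nth i = none := by
    intro i hi
    lift i to ℕ using by omega
    simp only [Turing.TM0.init, Turing.Tape.mk₁, Turing.Tape.mk₂, Turing.Tape.mk'_nth_nat,
      Turing.ListBlank.nth_mk]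
    rw [List.getI_eq_default _ (by simpa using hi)]
    rfl
  have h1 := TM.nth_eq_none_of_runs h0 j hc ((inp.length + j : ℕ) : ℤ) (by push_cast; rfl)
  rw [← Turing.Tape.right₀_nth, ho, Turing.ListBlank.nth_mk,
    List.getI_eq_getElem _ (by simp; omega)] at h1
  simp at h1

theorem length_unaryDecode_le (l : List Bool) : (unaryDecode l).length ≤ l.length := by
  induction l with
  | nil => simp [unaryDecode]
  | cons b l ih =>
    cases b
    · simpa [unaryDecode] using ih
    · simp only [unaryDecode]
      split
      · simp
      · next h => rw [h] at ih; simp at ih ⊢; omega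

theorem length_le_of_decodeCircuit {l : List ℕ} {C : Circuit} (h : decodeCircuit l = some C) :
    C.length ≤ l.length := by
  fun_induction decodeCircuit l generalizing C with
  | case1 => simp_all
  | case9 => simp at h
  | _ =>
    rename_i ih
    obtain ⟨D, hD, rfl⟩ := Option.map_eq_some_iff.1 h
    have := ih hD
    simp only [List.length_cons]
    omega

theorem length_unaryEncode (l : List ℕ) : (unaryEncode l).length = l.sum + l.length := by
  induction l with
  | nil => rfl
  | cons n l ih => simp [unaryEncode, ih]; omega

/-! ### QPT algorithms -/

theorem polynomial_eval_mono (p : Polynomial ℕ) : Monotone fun s => p.eval s := by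
  intro a b h
  simp only [Polynomial.eval_eq_sum, Polynomial.sum]
  gcongr

theorem PolyBounded.comp_add {ℓ κ m : ℕ → ℕ} (hℓ : PolyBounded ℓ) (hκ : PolyBounded κ)
    (hm : PolyBounded m) : PolyBounded fun s => ℓ (κ s + m s) := by
  obtain ⟨p, hp⟩ := hℓ
  obtain ⟨q, hq⟩ := hκ
  obtain ⟨r, hr⟩ := hm
  refine ⟨p.comp (q + r), fun s => (hp _).trans ?_⟩
  rw [Polynomial.eval_comp, Polynomial.eval_add]
  exact polynomial_eval_mono p (add_le_add (hq s) (hr s))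

/-- A machine cannot write more symbols than its input length plus its running time. This bound on
the number of queries and the countability below are all that the security proof uses about
efficiency. -/
theorem IsQPT.length_polyBounded {n κ m : ℕ → ℕ} {A : ℕ → Circuit} (hA : IsQPT n κ m A)
    (hn : PolyBounded n) (hκ : PolyBounded κ) (hm : PolyBounded m) :
    PolyBounded fun s => (A s).length := by
  obtain ⟨M, p, h⟩ := hA
  obtain ⟨pn, hn⟩ := hn
  obtain ⟨pκ, hκ⟩ := hκ
  obtain ⟨pm, hm⟩ := hm
  refine ⟨Polynomial.X + pn + pκ + pm + 4 + p, fun s => ?_⟩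
  obtain ⟨out, ho, hC⟩ := h s
  have h1 := length_le_of_decodeCircuit hC
  have h2 := length_unaryDecode_le out
  have h3 := ho.length_le
  rw [length_unaryEncode] at h3
  have := hn s
  have := hκ s
  have := hm s
  simp at h3 ⊢
  omega

/-- Transition tables are finite, hence countable in number, and a machine determines its family
because outputs are unique. -/
theorem countable_setOf_isQPT (n κ m : ℕ → ℕ) : {A : ℕ → Circuit | IsQPT n κ m A}.Countable := by
  have : Countable (Turing.TM0.Stmt Sym) := by
    refine Function.Injective.countable (β := Sym ⊕ Bool)
      (f := fun a => match a with | .move .left => .inr true | .move .right => .inr false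
                                  | .write b => .inl b) ?_
    rintro ((_ | _) | b) ((_ | _) | b') h <;> simp_all
  have hc : Countable TM := inferInstanceAs (Countable (List _))
  choose! M hM using fun (A : ℕ → Circuit) (hA : A ∈ {A | IsQPT n κ m A}) => hA
  refine Set.MapsTo.countable_of_injOn (Set.mapsTo_univ M _) ?_ Set.countable_univ
  intro A hA B hB hAB
  obtain ⟨p, hp⟩ := hM A hA
  obtain ⟨q, hq⟩ := hM B hB
  funext s
  obtain ⟨out, h1, h2⟩ := hp s
  obtain ⟨out', h1', h2'⟩ := hq s
  rw [hAB] at h1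
  rw [h1.unique h1'] at h2
  exact Option.some.inj (h2.symm.trans h2')

/-! ### The generator -/

/-- The generator: query the CHFS oracle on the concatenation of key and input. -/
def prfsGen (model : Model) (s n κ m : ℕ) : Circuit :=
  match model with
  | .isometry => [.chfs 0 (κ + m)]
  | .unitary => [.alloc (s + 1 + n), .chfs 0 (κ + m)]

theorem prfsGen_isQPT (model : Model) {n κ m : ℕ → ℕ} (hn : PolyBounded n) (hκ : PolyBounded κ)
    (hm : PolyBounded m) : IsQPT n κ m fun s => prfsGen model s (n s) (κ s) (m s) := by
  obtain ⟨pn, hn⟩ := hn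
  obtain ⟨pκ, hκ⟩ := hκ
  obtain ⟨pm, hm⟩ := hm
  have mono : ∀ {M : TM} {inp out : List Bool} {t t' : ℕ}, M.OutputsWithin inp t out → t ≤ t' →
      M.OutputsWithin inp t' out := fun ⟨j, c, hj, h⟩ ht => ⟨j, c, hj.trans ht, h⟩
  cases model with
  | isometry =>
    refine ⟨isometryGenTM, 2 * Polynomial.X + 2 * pn + 2 * pκ + 2 * pm + 100, fun s =>
      ⟨_, mono (isometryGenTM_outputsWithin _ _ _ _) ?_, ?_⟩⟩
    · have := hn s
      have := hκ s
      have := hm s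
      simp
      omega
    · rw [unaryDecode_unaryEncode]; rfl
  | unitary =>
    refine ⟨unitaryGenTM, 2 * Polynomial.X + 2 * pn + 2 * pκ + 2 * pm + 100, fun s =>
      ⟨_, mono (unitaryGenTM_outputsWithin _ _ _ _) ?_, ?_⟩⟩
    · have := hn s
      have := hκ s
      have := hm s
      simp
      omega
    · rw [unaryDecode_unaryEncode]; rfl

/-! ### States as vectors of a Hilbert space -/

theorem orthonormal_lpSingle :
    Orthonormal ℂ fun b : Basis => (lp.single 2 b (1 : ℂ) : lp (fun _ : Basis => ℂ) 2) := by
  have := (HilbertBasis.ofRepr (LinearIsometryEquiv.refl ℂ (lp (fun _ : Basis => ℂ) 2))).orthonormal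
  convert this with b
  exact HilbertBasis.repr_symm_single (HilbertBasis.ofRepr (LinearIsometryEquiv.refl ℂ _)) b

/-- A finitely supported state as a vector of `ℓ²`. -/
def vec : QState →ₗ[ℂ] lp (fun _ : Basis => ℂ) 2 :=
  Finsupp.linearCombination ℂ fun b => lp.single 2 b (1 : ℂ)

theorem inner_vec (ψ φ : QState) : ⟪vec ψ, vec φ⟫_ℂ = ψ.sum fun b c => conj c * φ b := by
  exact orthonormal_lpSingle.inner_finsupp_eq_sum_left ψ φ

theorem norm_sq_vec (ψ : QState) : ‖vec ψ‖ ^ 2 = ψ.sum fun _ c => ‖c‖ ^ 2 := by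
  have h := inner_self_eq_norm_sq_to_K (𝕜 := ℂ) (vec ψ)
  rw [inner_vec] at h
  have h2 : ((ψ.sum fun _ c => ‖c‖ ^ 2 : ℝ) : ℂ) = ψ.sum fun b c => conj c * ψ b := by
    simp only [Finsupp.sum, Complex.ofReal_sum]
    refine Finset.sum_congr rfl fun b _ => ?_
    rw [mul_comm, Complex.mul_conj, Complex.normSq_eq_norm_sq]
  rw [← h2] at h
  apply Complex.ofReal_injective
  rw [h]
  simp

theorem inner_vec_eq_zero {ψ φ : QState} (h : ∀ b ∈ ψ.support, b ∉ φ.support) :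
    ⟪vec ψ, vec φ⟫_ℂ = 0 := by
  rw [inner_vec]
  refine Finset.sum_eq_zero fun b hb => ?_
  simp [Finsupp.notMem_support_iff.1 (h b hb)]

theorem inner_vec_sum {ι : Type*} [Fintype ι] (u v : ι → ℂ) {p : ι → Basis}
    (hp : Function.Injective p) :
    ⟪vec (∑ i, u i • Finsupp.single (p i) 1), vec (∑ i, v i • Finsupp.single (p i) 1)⟫_ℂ =
      ∑ i, conj (u i) * v i := by
  simp only [map_sum, map_smul, vec, Finsupp.linearCombination_single, one_smul]
  exact (orthonormal_lpSingle.comp p hp).inner_sum u v Finset.univ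

theorem inner_vec_single (b b' : Basis) (c c' : ℂ) :
    ⟪vec (Finsupp.single b c), vec (Finsupp.single b' c')⟫_ℂ = if b = b' then conj c * c' else 0 := by
  rw [inner_vec, Finsupp.sum_single_index (by simp), Finsupp.single_apply]
  simp [eq_comm]

/-- The states all of whose basis states have `L` wires. -/
def lenSpace (L : ℕ) : Submodule ℂ QState := Finsupp.supported ℂ ℂ {b | b.1.length = L}

theorem mem_lenSpace {L : ℕ} {ψ : QState} :
    ψ ∈ lenSpace L ↔ ∀ b ∈ ψ.support, b.1.length = L := by
  simp [lenSpace, Finsupp.mem_supported, Set.subset_def]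

theorem ket_mem_lenSpace (s : List Bool) (e : List (List Bool)) : ket s e ∈ lenSpace s.length :=
  Finsupp.single_mem_supported ℂ 1 (by simp)

/-- On basis states with `L` wires, `f` takes orthonormal values with `L'` wires. -/
structure IsoOn (f : Basis → QState) (L L' : ℕ) : Prop where
  mem : ∀ b : Basis, b.1.length = L → f b ∈ lenSpace L'
  inner : ∀ b b' : Basis, b.1.length = L → b'.1.length = L →
    ⟪vec (f b), vec (f b')⟫_ℂ = if b = b' then 1 else 0

theorem applyOp_ket (f : Basis → QState) (s : List Bool) (e : List (List Bool)) :
    applyOp f (ket s e) = f (s, e) := by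
  simp [applyOp, ket]

theorem applyOp_add (f : Basis → QState) (ψ φ : QState) :
    applyOp f (ψ + φ) = applyOp f ψ + applyOp f φ := map_add _ _ _

theorem applyOp_sub (f : Basis → QState) (ψ φ : QState) :
    applyOp f (ψ - φ) = applyOp f ψ - applyOp f φ := map_sub _ _ _

theorem applyOp_congr {f g : Basis → QState} {ψ : QState} (h : ∀ b ∈ ψ.support, f b = g b) :
    applyOp f ψ = applyOp g ψ := by
  simp only [applyOp, Finsupp.linearCombination_apply]
  exact Finsupp.sum_congr fun b hb => by rw [h b hb]

theorem applyOp_mem {f : Basis → QState} {ψ : QState} {W : Submodule ℂ QState}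
    (h : ∀ b ∈ ψ.support, f b ∈ W) : applyOp f ψ ∈ W := by
  simp only [applyOp, Finsupp.linearCombination_apply]
  exact W.sum_mem fun b hb => W.smul_mem _ (h b hb)

/-! ### Isometries between spaces of states with fixed numbers of wires -/

namespace IsoOn

variable {f g : Basis → QState} {L L' L'' : ℕ}

theorem applyOp_mem (hf : IsoOn f L L') {ψ : QState} (hψ : ψ ∈ lenSpace L) :
    applyOp f ψ ∈ lenSpace L' :=
  CHFS.applyOp_mem fun b hb => hf.mem b (mem_lenSpace.1 hψ b hb)

theorem inner_applyOp (hf : IsoOn f L L') {ψ φ : QState} (hψ : ψ ∈ lenSpace L)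
    (hφ : φ ∈ lenSpace L) : ⟪vec (applyOp f ψ), vec (applyOp f φ)⟫_ℂ = ⟪vec ψ, vec φ⟫_ℂ := by
  rw [inner_vec ψ φ]
  simp only [applyOp, Finsupp.linearCombination_apply, Finsupp.sum, map_sum, map_smul,
    sum_inner, inner_sum, inner_smul_left, inner_smul_right]
  simp only [Finset.mul_sum]
  rw [Finset.sum_comm]
  refine Finset.sum_congr rfl fun b hb => ?_
  have h : ∀ b' ∈ φ.support, φ b' * (conj (ψ b) * ⟪vec (f b), vec (f b')⟫_ℂ) =
      if b = b' then conj (ψ b) * φ b else 0 := by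
    intro b' hb'
    rw [hf.inner b b' (mem_lenSpace.1 hψ b hb) (mem_lenSpace.1 hφ b' hb')]
    split_ifs with hbb
    · rw [hbb, mul_one, mul_comm]
    · simp
  rw [Finset.sum_congr rfl h, Finset.sum_ite_eq]
  split_ifs with hb'
  · rfl
  · simp [Finsupp.notMem_support_iff.1 hb']

theorem norm_applyOp (hf : IsoOn f L L') {ψ : QState} (hψ : ψ ∈ lenSpace L) :
    ‖vec (applyOp f ψ)‖ = ‖vec ψ‖ := by
  have h := hf.inner_applyOp hψ hψ
  rw [inner_self_eq_norm_sq_to_K, inner_self_eq_norm_sq_to_K] at h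
  have h' : ‖vec (applyOp f ψ)‖ ^ 2 = ‖vec ψ‖ ^ 2 := by exact_mod_cast h
  exact (sq_eq_sq₀ (norm_nonneg _) (norm_nonneg _)).1 h'

theorem comp (hf : IsoOn f L L') (hg : IsoOn g L' L'') :
    IsoOn (fun b => applyOp g (f b)) L L'' where
  mem b hb := hg.applyOp_mem (hf.mem b hb)
  inner b b' hb hb' := by rw [hg.inner_applyOp (hf.mem b hb) (hf.mem b' hb'), hf.inner b b' hb hb']

theorem congr (hf : IsoOn f L L') (h : ∀ b : Basis, b.1.length = L → g b = f b) :
    IsoOn g L L' where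
  mem b hb := by rw [h b hb]; exact hf.mem b hb
  inner b b' hb hb' := by rw [h b hb, h b' hb']; exact hf.inner b b' hb hb'

/-- Orthonormality has to be checked only for basis states with the same value of `key`, provided
that this value can be recovered from the result. -/
theorem of_key {α : Type*} (key ret : Basis → α)
    (hmem : ∀ b : Basis, b.1.length = L → f b ∈ lenSpace L')
    (hrec : ∀ b : Basis, b.1.length = L → ∀ b' ∈ (f b).support, ret b' = key b)
    (h : ∀ b b' : Basis, b.1.length = L → b'.1.length = L → key b = key b' →
      ⟪vec (f b), vec (f b')⟫_ℂ = if b = b' then 1 else 0) : IsoOn f L L' where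
  mem := hmem
  inner b b' hb hb' := by
    by_cases hk : key b = key b'
    · exact h b b' hb hb' hk
    · rw [if_neg (fun hbb : b = b' => hk (hbb ▸ rfl))]
      exact inner_vec_eq_zero fun c hc hc' => hk ((hrec b hb c hc).symm.trans (hrec b' hb' c hc'))

theorem of_single {c : Basis → ℂ} {σ : Basis → Basis}
    (hf : ∀ b : Basis, b.1.length = L → f b = Finsupp.single (σ b) (c b))
    (hc : ∀ b, ‖c b‖ = 1) (hσ : ∀ b : Basis, b.1.length = L → (σ b).1.length = L')
    (hinj : ∀ b b' : Basis, b.1.length = L → b'.1.length = L → σ b = σ b' → b = b') :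
    IsoOn f L L' where
  mem b hb := by rw [hf b hb]; exact Finsupp.single_mem_supported ℂ _ (hσ b hb)
  inner b b' hb hb' := by
    rw [hf b hb, hf b' hb', inner_vec_single]
    by_cases h : b = b'
    · subst h
      simp [Complex.conj_mul', hc]
    · rw [if_neg h, if_neg (fun hh => h (hinj b b' hb hb' hh))]

protected theorem refl : IsoOn (fun b => ket b.1 b.2) L L :=
  of_single (c := fun _ => 1) (σ := id) (fun _ _ => rfl) (by simp) (by simp) (by simp)

theorem run_eq {ι : Type*} {F : ι → Basis → QState} {C : List ι} (h : ∀ i ∈ C, IsoOn (F i) L L) :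
    IsoOn (fun b => C.foldl (fun ψ i => applyOp (F i) ψ) (ket b.1 b.2)) L L := by
  induction C using List.reverseRecOn with
  | nil => exact IsoOn.refl
  | append_singleton C i ih =>
    simp only [List.foldl_append, List.foldl_cons, List.foldl_nil]
    exact (ih fun j hj => h j (by simp [hj])).comp (h i (by simp))

end IsoOn

/-! ### The elementary operations are isometries -/

theorem set_set_getD (s : List Bool) (i : ℕ) (b : Bool) :
    (s.set i b).set i (s.getD i false) = s := by
  refine List.ext_getElem (by simp) fun j h1 _ => ?_
  by_cases hij : i = j
  · subst hij
    simp at h1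
    simp [h1]
  · simp [List.getElem_set_ne hij]

theorem IsoOn.had (o i L : ℕ) : IsoOn ((Gate.had i).op o) L L := by
  by_cases hi : o + i < L
  swap
  · refine IsoOn.refl.congr ?_
    rintro ⟨s, e⟩ hb
    simp only at hb
    subst hb
    simp [Gate.op, hi]
  have hop : ∀ b : Basis, b.1.length = L → (Gate.had i).op o b =
      ∑ z : Bool, (((1 / √2 : ℝ) : ℂ) * (if b.1.getD (o + i) false && z then -1 else 1)) •
        Finsupp.single (b.1.set (o + i) z, b.2) (1 : ℂ) := by
    rintro ⟨s, e⟩ hb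
    simp only at hb
    subst hb
    simp only [Gate.op, hi, if_true, Fintype.sum_bool, ket, smul_add, smul_smul, Bool.and_true,
      Bool.and_false, Bool.false_eq_true, if_false, mul_one]
    rw [add_comm]
  -- The key erases the wire acted on. Once all other wires agree, only the orthonormality of the
  -- columns of the 2×2 Hadamard matrix is left.
  refine IsoOn.of_key (fun b => (b.1.set (o + i) false, b.2)) (fun b => (b.1.set (o + i) false, b.2))
    ?_ ?_ ?_
  · intro b hb
    rw [hop b hb]
    exact Submodule.sum_mem _ fun z _ => Submodule.smul_mem _ _
      (Finsupp.single_mem_supported ℂ _ (by simpa using hb))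
  · intro b hb b' hb'
    rw [hop b hb] at hb'
    obtain ⟨z, -, hz⟩ := Finsupp.mem_support_finsetSum _ hb'
    have := Finsupp.support_smul hz
    have := Finsupp.support_single_subset this
    simp only [Finset.mem_singleton] at this
    subst this
    simp
  · rintro ⟨s, e⟩ ⟨s', e'⟩ hb hb' hk
    simp only [Prod.mk.injEq] at hk hb hb'
    obtain ⟨hk, rfl⟩ := hk
    have hset : ∀ z, s.set (o + i) z = s'.set (o + i) z := by
      intro z
      have := congrArg (fun l => List.set l (o + i) z) hk
      simpa using this
    rw [hop _ hb, hop _ hb']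
    simp only [hset]
    rw [inner_vec_sum _ _ (p := fun z => (s'.set (o + i) z, e))]
    · have heq : ((s, e) : Basis) = (s', e) ↔ s.getD (o + i) false = s'.getD (o + i) false := by
        constructor
        · intro h; rw [(Prod.mk.inj h).1]
        · intro h
          have h1 := set_set_getD s (o + i) false
          rw [hset, h, set_set_getD] at h1
          rw [h1]
      have h2 : ((√2 : ℝ) : ℂ) ^ 2 = 2 := by
        rw [← Complex.ofReal_pow, Real.sq_sqrt (by norm_num)]; norm_num
      have h0 : ((√2 : ℝ) : ℂ) ≠ 0 := by
        intro h; rw [h] at h2; norm_num at h2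
      simp only [heq]
      cases s.getD (o + i) false <;> cases s'.getD (o + i) false <;>
        simp <;> field_simp <;> rw [h2] <;> norm_num
    · intro z z' h
      have h := (Prod.mk.inj h).1
      have := congrArg (fun l => List.getD l (o + i) false) h
      simpa [hb', hi] using this

theorem IsoOn.tgate (o i L : ℕ) : IsoOn ((Gate.t i).op o) L L := by
  refine IsoOn.of_single (c := fun b => if b.1.getD (o + i) false then
    Complex.exp (Complex.I * (Real.pi / 4 : ℝ)) else 1) (σ := id) ?_ ?_ (by simp) (by simp)
  · rintro ⟨s, e⟩ _
    simp only [Gate.op, ket]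
    split_ifs <;> simp
  · intro b
    split_ifs
    · rw [mul_comm]; exact Complex.norm_exp_ofReal_mul_I _
    · simp

theorem set_not_injective {s s' : List Bool} {j : ℕ}
    (h : s.set j (!s.getD j false) = s'.set j (!s'.getD j false)) (hj : j < s.length)
    (hj' : j < s'.length) : s = s' := by
  have h1 := congrArg (fun l => List.getD l j false) h
  simp [hj, hj'] at h1
  rw [← set_set_getD s j (!s.getD j false), h]
  have : s.getD j false = s'.getD j false := by simp [hj, hj', h1]
  rw [this, set_set_getD]

theorem IsoOn.cnot (o i j L : ℕ) : IsoOn ((Gate.cnot i j).op o) L L := by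
  refine IsoOn.of_single (c := fun _ => 1) (σ := fun b =>
    if i ≠ j ∧ o + i < b.1.length ∧ o + j < b.1.length ∧ b.1.getD (o + i) false then
      (b.1.set (o + j) (!b.1.getD (o + j) false), b.2) else b) ?_ (by simp) ?_ ?_
  · rintro ⟨s, e⟩ _
    simp only [Gate.op, ket]
    split_ifs <;> rfl
  · rintro b hb
    split_ifs <;> simp [hb]
  · rintro ⟨s, e⟩ ⟨s', e'⟩ hb hb' h
    simp only at hb hb' h
    by_cases hc : i ≠ j ∧ o + i < L ∧ o + j < L
    swap
    · rw [if_neg (fun hh => hc ⟨hh.1, hb ▸ hh.2.1, hb ▸ hh.2.2.1⟩),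
        if_neg (fun hh => hc ⟨hh.1, hb' ▸ hh.2.1, hb' ▸ hh.2.2.1⟩)] at h
      exact h
    obtain ⟨hij, hi, hj⟩ := hc
    -- The control wire survives because `i ≠ j`, so the result reveals whether the target was
    -- flipped.
    have key : ∀ t : List Bool, (t.set (o + j) (!t.getD (o + j) false)).getD (o + i) false =
        t.getD (o + i) false := by
      intro t
      simp only [List.getD_eq_getElem?_getD]
      rw [List.getElem?_set_ne (by omega)]
    simp only [hb, hb', hij, hi, hj, ne_eq, not_false_eq_true, true_and] at h
    by_cases h1 : s.getD (o + i) false = true <;> by_cases h2 : s'.getD (o + i) false = true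
    · rw [if_pos h1, if_pos h2, Prod.mk.injEq] at h
      rw [h.2, set_not_injective h.1 (by omega) (by omega)]
    · rw [if_pos h1, if_neg h2, Prod.mk.injEq] at h
      rw [← h.1, key] at h2
      exact absurd h1 h2
    · rw [if_neg h1, if_pos h2, Prod.mk.injEq] at h
      rw [h.1, key] at h1
      exact absurd h2 h1
    · rwa [if_neg h1, if_neg h2] at h

theorem Gate.isoOn (g : Gate) (o L : ℕ) : IsoOn (g.op o) L L := by
  cases g with
  | had i => exact IsoOn.had o i L
  | t i => exact IsoOn.tgate o i L
  | cnot i j => exact IsoOn.cnot o i j L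

/-! ### The oracles are isometries -/

theorem sum_conj_mul_self_pureState {n : ℕ} (φ : PureState n) :
    ∑ y, conj (φ.1 y) * φ.1 y = 1 := by
  have h := EuclideanSpace.norm_sq_eq φ.1
  rw [norm_eq_of_mem_sphere φ] at h
  have h2 : ((∑ y, ‖φ.1 y‖ ^ 2 : ℝ) : ℂ) = 1 := by rw [← h]; simp
  rw [← h2, Complex.ofReal_sum]
  refine Finset.sum_congr rfl fun y _ => ?_
  rw [Complex.conj_mul', Complex.ofReal_pow]

/-- The measured value forgotten again. -/
def Access.unrecord (acc : Access) (e : List (List Bool)) : List (List Bool) :=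
  match acc with
  | .quantum => e
  | .classical => e.tail

@[simp]
theorem Access.unrecord_record (acc : Access) (x : List Bool) (e : List (List Bool)) :
    acc.unrecord (acc.record x e) = e := by
  cases acc <;> rfl

/-- The state `φ` on new wires. -/
def appendState {n : ℕ} (φ : PureState n) (s : List Bool) (e : List (List Bool)) : QState :=
  ∑ y : Fin n → Bool, φ.1 y • ket (s ++ List.ofFn y) e

theorem mem_support_appendState {n : ℕ} {φ : PureState n} {s : List Bool} {e : List (List Bool)}
    {b : Basis} (hb : b ∈ (appendState φ s e).support) : ∃ y : Fin n → Bool, b = (s ++ List.ofFn y, e) := by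
  obtain ⟨y, -, hy⟩ := Finsupp.mem_support_finsetSum _ hb
  exact ⟨y, by simpa using Finsupp.support_single_subset (Finsupp.support_smul hy)⟩

theorem inner_appendState {n : ℕ} (φ : PureState n) (s : List Bool) (e : List (List Bool)) :
    ⟪vec (appendState φ s e), vec (appendState φ s e)⟫_ℂ = 1 := by
  unfold appendState ket
  rw [inner_vec_sum (fun y => φ.1 y) _ (p := fun y => (s ++ List.ofFn y, e)), sum_conj_mul_self_pureState]
  intro y y' h
  simpa using h

/-- An operation that appends a state depending on the wires is an isometry. -/
theorem IsoOn.append {f : Basis → QState} {L L' n : ℕ} (acc : Access) (x : List Bool → List Bool)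
    (ν : List Bool → ℕ) (φ : (s : List Bool) → PureState (ν s)) (hν : ∀ s, s.length = L → ν s = n)
    (hL : L' = L + n)
    (hf : ∀ s e, s.length = L → f (s, e) = appendState (φ s) s (acc.record (x s) e)) :
    IsoOn f L L' := by
  subst hL
  -- The old wires and the old environment can be read off the result, so different inputs have
  -- disjoint supports and only the norm of the appended state matters.
  refine IsoOn.of_key (fun b => b) (fun b => (b.1.take L, acc.unrecord b.2)) ?_ ?_ ?_
  · rintro ⟨s, e⟩ hs
    rw [mem_lenSpace, hf s e hs]
    intro b hb
    obtain ⟨y, rfl⟩ := mem_support_appendState hb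
    simp only at hs
    simp [hs, hν]
  · rintro ⟨s, e⟩ hs b hb
    rw [hf s e hs] at hb
    obtain ⟨y, rfl⟩ := mem_support_appendState hb
    simp only at hs
    subst hs
    simp
  · rintro ⟨s, e⟩ _ hs - rfl
    rw [hf s e hs, inner_appendState, if_pos rfl]

theorem length_block {s : List Bool} {a d : ℕ} (h : a + d ≤ s.length) : (block s a d).length = d := by
  simp [block]; omega

theorem IsoOn.isometryOp (ℓ : ℕ → ℕ) (acc : Access) (a d L : ℕ) :
    ∃ L', ∀ Φ : StateFamily ℓ, IsoOn (CHFS.isometryOp Φ acc a d) L L' := by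
  by_cases h : a + d ≤ L
  · refine ⟨L + ℓ d, fun Φ => IsoOn.append (n := ℓ d) acc (fun s => block s a d)
      (fun s => ℓ (block s a d).length) (fun s => Φ (block s a d)) ?_ rfl ?_⟩
    · intro s hs
      rw [length_block (by omega)]
    · intro s e hs
      simp only [CHFS.isometryOp]
      rw [if_pos (by omega)]
      rfl
  · refine ⟨L, fun Φ => IsoOn.refl.congr ?_⟩
    rintro ⟨s, e⟩ hs
    simp only at hs
    simp only [CHFS.isometryOp]
    rw [if_neg (by omega)]

theorem IsoOn.haarOracle (acc : Access) (m n a L : ℕ) :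
    ∃ L', ∀ Ψ : (Fin m → Bool) → PureState n, IsoOn (CHFS.haarOracle acc m n Ψ a) L L' := by
  by_cases h : a + m ≤ L
  · refine ⟨L + n, fun Ψ => IsoOn.append (n := n) acc (fun s => block s a m)
      (fun _ => n) (fun s => Ψ fun i => s.getD (a + i) false) (fun _ _ => rfl) rfl ?_⟩
    intro s e hs
    simp only [CHFS.haarOracle]
    rw [if_pos (by omega)]
    rfl
  · refine ⟨L, fun Ψ => IsoOn.refl.congr ?_⟩
    rintro ⟨s, e⟩ hs
    simp only at hs
    simp only [CHFS.haarOracle]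
    rw [if_neg (by omega)]

/-- The last bit separates `|0⋯0⟩` from `|φ⟩|1⟩`, so the cross terms vanish and the two unit vectors
contribute one half each. -/
theorem sum_conj_mul_self_minusVec {n : ℕ} (φ : PureState n) :
    ∑ z, conj (minusVec φ z) * minusVec φ z = 1 := by
  have h2 : ((1 / √2 : ℝ) : ℂ) * ((1 / √2 : ℝ) : ℂ) = 1 / 2 := by
    rw [← Complex.ofReal_mul, div_mul_div_comm, Real.mul_self_sqrt (by norm_num)]
    norm_num
  have hz : ∀ z : Fin (n + 1) → Bool, conj (minusVec φ z) * minusVec φ z =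
      1 / 2 * (if z = fun _ => false then 1 else 0) + 1 / 2 * (if z (Fin.last n) then
        conj (φ.1 fun i => z i.castSucc) * φ.1 (fun i => z i.castSucc) else 0) := by
    intro z
    simp only [minusVec, map_mul, Complex.conj_ofReal, mul_mul_mul_comm, h2]
    by_cases h0 : z = fun _ => false
    · simp [h0]
    · by_cases h1 : z (Fin.last n) <;> simp [h0, h1]
  simp only [hz, Finset.sum_add_distrib, ← Finset.mul_sum, Finset.sum_ite_eq', Finset.mem_univ,
    if_true]
  rw [← (Fin.snocEquiv fun _ : Fin (n + 1) => Bool).sum_comp, Fintype.sum_prod_type]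
  simp only [Fintype.sum_bool, Fin.snocEquiv_apply, Fin.snoc_last, Fin.snoc_castSucc, if_true,
    Bool.false_eq_true, if_false, Finset.sum_const_zero, add_zero]
  rw [sum_conj_mul_self_pureState]
  norm_num

/-- For a unit vector `v`, `(I - 2vv*)² = I - 4vv* + 4v(v*v)v* = I`. -/
theorem sum_conj_swapEntry_mul_swapEntry {n : ℕ} (φ : PureState n) (y y' : Fin (n + 1) → Bool) :
    ∑ z, conj (swapEntry φ z y) * swapEntry φ z y' = if y = y' then 1 else 0 := by
  have hz : ∀ z, conj (swapEntry φ z y) * swapEntry φ z y' =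
      (if z = y then (if y = y' then 1 else 0) else 0)
        - (if z = y then 2 * minusVec φ y * conj (minusVec φ y') else 0)
        - (if z = y' then 2 * conj (minusVec φ y') * minusVec φ y else 0)
        + 4 * minusVec φ y * conj (minusVec φ y') * (conj (minusVec φ z) * minusVec φ z) := by
    intro z
    simp only [swapEntry, map_sub, map_mul, Complex.conj_conj, map_ofNat]
    by_cases h : z = y <;> by_cases h' : z = y'
    · subst h; subst h'; simp; ring
    · subst h; simp [h']; ring
    · subst h'; simp [h]; ring
    · simp [h, h']; ring
  simp only [hz, Finset.sum_add_distrib, Finset.sum_sub_distrib, ← Finset.mul_sum,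
    sum_conj_mul_self_minusVec, Finset.sum_ite_eq', Finset.mem_univ, if_true]
  ring

theorem eq_take_append_ofFn_append_drop {s : List Bool} {a d : ℕ} (h : a + d ≤ s.length) :
    s = s.take a ++ List.ofFn (fun i : Fin d => s.getD (a + i) false) ++ s.drop (a + d) := by
  have : List.ofFn (fun i : Fin d => s.getD (a + i) false) = (s.drop a).take d := by
    refine List.ext_getElem (by simp; omega) fun j h1 h2 => ?_
    simp at h1 h2
    simp [show a + j < s.length by omega]
  rw [this, List.append_assoc, ← List.drop_drop, List.take_append_drop, List.take_append_drop]

theorem block_eq_ofFn {s : List Bool} {a d : ℕ} (h : a + d ≤ s.length) :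
    block s a d = List.ofFn (fun i : Fin d => s.getD (a + i) false) := by
  refine List.ext_getElem (by simp [length_block h]) fun j h1 h2 => ?_
  simp at h2
  simp [block, show a + j < s.length by omega]

theorem block_eq_drop_take (s : List Bool) (a d : ℕ) : block s a d = (s.take (a + d)).drop a := by
  simp [block, List.drop_take]

/-- The result of applying the reflection `S` to the wires `c, …, c + n`. -/
def swapState {n : ℕ} (φ : PureState n) (c : ℕ) (s : List Bool) (e : List (List Bool)) : QState :=
  ∑ z : Fin (n + 1) → Bool, swapEntry φ z (fun i => s.getD (c + i) false) •
    ket (s.take c ++ List.ofFn z ++ s.drop (c + (n + 1))) e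

theorem mem_support_swapState {n : ℕ} {φ : PureState n} {c : ℕ} {s : List Bool}
    {e : List (List Bool)} {b : Basis} (hb : b ∈ (swapState φ c s e).support) :
    ∃ z : Fin (n + 1) → Bool, b = (s.take c ++ List.ofFn z ++ s.drop (c + (n + 1)), e) := by
  obtain ⟨y, -, hy⟩ := Finsupp.mem_support_finsetSum _ hb
  exact ⟨y, by simpa using Finsupp.support_single_subset (Finsupp.support_smul hy)⟩

theorem IsoOn.unitaryOp {ℓ : ℕ → ℕ} (Φ : StateFamily ℓ) (acc : Access) (a d L : ℕ) :
    IsoOn (CHFS.unitaryOp Φ acc a d) L L := by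
  by_cases h : a + d + (ℓ d + 1) ≤ L
  swap
  · refine IsoOn.refl.congr ?_
    rintro ⟨s, e⟩ hs
    simp only at hs
    simp only [CHFS.unitaryOp]
    rw [if_neg (by omega)]
  have hlen : ∀ s : List Bool, s.length = L → ℓ (block s a d).length = ℓ d := by
    intro s hs
    rw [length_block (by omega)]
  have hop : ∀ s e, s.length = L → CHFS.unitaryOp Φ acc a d (s, e) =
      swapState (Φ (block s a d)) (a + d) s (acc.record (block s a d) e) := by
    intro s e hs
    simp only [CHFS.unitaryOp]
    rw [if_pos (by omega)]
    rfl
  -- The key consists of everything outside the target register. It contains the queried `x`, so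
  -- basis states with equal keys meet the same matrix `S_x`, which is unitary.
  refine IsoOn.of_key (fun b => (b.1.take (a + d), b.1.drop (a + d + (ℓ d + 1)), b.2))
    (fun b => (b.1.take (a + d), b.1.drop (a + d + (ℓ d + 1)), acc.unrecord b.2)) ?_ ?_ ?_
  · rintro ⟨s, e⟩ hs
    simp only at hs
    rw [mem_lenSpace, hop s e hs]
    intro b hb
    obtain ⟨z, rfl⟩ := mem_support_swapState hb
    simp [hlen s hs, hs]
    omega
  · rintro ⟨s, e⟩ hs b hb
    simp only at hs
    rw [hop s e hs] at hb
    obtain ⟨z, rfl⟩ := mem_support_swapState hb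
    have h1 : (s.take (a + d)).length = a + d := by simp; omega
    have h2 : (s.take (a + d) ++ List.ofFn z).length = a + d + (ℓ d + 1) := by
      simp [h1, hlen s hs]
    refine Prod.ext ?_ (Prod.ext ?_ ?_)
    · simp only [List.append_assoc]
      exact List.take_left' h1
    · exact (List.drop_left' h2).trans (by rw [hlen s hs])
    · simp
  · rintro ⟨s, e⟩ ⟨s', e'⟩ hs hs' hk
    simp only [Prod.mk.injEq] at hs hs' hk
    obtain ⟨ht, hd, rfl⟩ := hk
    have hx : block s a d = block s' a d := by rw [block_eq_drop_take, ht, block_eq_drop_take]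
    rw [hop s e hs, hop s' e hs', hx]
    have hd' : s.drop (a + d + (ℓ (block s' a d).length + 1)) =
      s'.drop (a + d + (ℓ (block s' a d).length + 1)) := by rw [hlen s' hs', hd]
    unfold swapState ket
    rw [ht, hd']
    rw [inner_vec_sum _ _ (p := fun z : Fin (ℓ (block s' a d).length + 1) → Bool =>
      (s'.take (a + d) ++ List.ofFn z ++ s'.drop (a + d + (ℓ (block s' a d).length + 1)),
        acc.record (block s' a d) e)), sum_conj_swapEntry_mul_swapEntry]
    · congr 1
      rw [eq_iff_iff]
      constructor
      · intro hy
        have h1 := eq_take_append_ofFn_append_drop (s := s) (a := a + d)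
          (d := ℓ (block s' a d).length + 1) (by rw [hlen s' hs']; omega)
        rw [ht, hd', hy, ← eq_take_append_ofFn_append_drop (by rw [hlen s' hs']; omega)] at h1
        rw [h1]
      · intro hy
        rw [(Prod.mk.inj hy).1]
    · intro z z' hz
      exact List.ofFn_injective (List.append_cancel_left (List.append_cancel_right (Prod.mk.inj hz).1))

theorem Gate.take_eq_of_mem_support (g : Gate) (o : ℕ) {b b' : Basis}
    (h : b' ∈ (g.op o b).support) : b'.1.take o = b.1.take o := by
  obtain ⟨s, e⟩ := b
  have hk : ∀ {c : ℂ} {t : List Bool}, b' ∈ (c • ket t e).support → b' = (t, e) := by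
    intro c t h
    simpa using Finsupp.support_single_subset (Finsupp.support_smul h)
  have hk' : ∀ {t : List Bool}, b' ∈ (ket t e).support → b' = (t, e) := by
    intro t h
    exact hk (c := 1) (by simpa using h)
  have hset : ∀ (i : ℕ) (v : Bool), (s.set (o + i) v).take o = s.take o := by
    intro i v
    rw [List.take_set_of_le (by omega)]
  cases g with
  | had i =>
    simp only [Gate.op] at h
    split_ifs at h
    · replace h := Finsupp.support_smul h
      rcases Finset.mem_union.1 (Finsupp.support_add h) with h | h
      · rw [hk' h, hset]
      · rw [hk h, hset]
    · replace h := Finsupp.support_smul h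
      rcases Finset.mem_union.1 (Finsupp.support_add h) with h | h
      · rw [hk' h, hset]
      · rw [hk h, hset]
    · rw [hk' h]
  | t i => rw [hk h]
  | cnot i j =>
    simp only [Gate.op] at h
    split_ifs at h
    · rw [hk' h, hset]
    · rw [hk' h]

/-- Gates shifted by `o` leave the wires below `o` alone. For QPSPACE these include the machine and
time registers, which can therefore serve as the key. -/
theorem take_eq_of_mem_support_runGates (o : ℕ) (C : List Gate) {b b' : Basis}
    (h : b' ∈ (runGates o C (ket b.1 b.2)).support) : b'.1.take o = b.1.take o := by
  induction C using List.reverseRecOn generalizing b' with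
  | nil =>
    have : b' = b := by simpa using Finsupp.support_single_subset h
    rw [this]
  | append_singleton C g ih =>
    have hmem : runGates o (C ++ [g]) (ket b.1 b.2) ∈
        Finsupp.supported ℂ ℂ {b' : Basis | b'.1.take o = b.1.take o} := by
      simp only [runGates, List.foldl_append, List.foldl_cons, List.foldl_nil]
      refine applyOp_mem fun c hc => ?_
      rw [Finsupp.mem_supported]
      intro c' hc'
      exact (g.take_eq_of_mem_support o hc').trans (ih hc)
    exact (Finsupp.mem_supported ℂ _).1 hmem h

theorem IsoOn.runGates (o : ℕ) (C : List Gate) (L : ℕ) :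
    IsoOn (fun b => CHFS.runGates o C (ket b.1 b.2)) L L :=
  IsoOn.run_eq fun g _ => g.isoOn o L

theorem IsoOn.not (j L : ℕ) : IsoOn (fun b => ket (b.1.set j (!b.1.getD j false)) b.2) L L := by
  by_cases hj : j < L
  · refine IsoOn.of_single (c := fun _ => 1) (σ := fun b => (b.1.set j (!b.1.getD j false), b.2))
      (fun _ _ => rfl) (by simp) (by simp) ?_
    rintro ⟨s, e⟩ ⟨s', e'⟩ hs hs' h
    simp only [Prod.mk.injEq] at hs hs' h
    rw [h.2, set_not_injective h.1 (by omega) (by omega)]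
  · refine IsoOn.refl.congr fun b hb => ?_
    rw [List.set_eq_of_length_le (by omega)]

theorem IsoOn.qpspaceOp (a c₁ c₂ w L : ℕ) : IsoOn (CHFS.qpspaceOp a c₁ c₂ w) L L := by
  classical
  by_cases h : a + c₁ + c₂ + w + 1 ≤ L
  swap
  · refine IsoOn.refl.congr ?_
    rintro ⟨s, e⟩ hs
    simp only at hs
    simp only [CHFS.qpspaceOp]
    rw [if_neg (by omega)]
  -- `F r` is the operation applied when the wires before the quantum input have values `r`. QPSPACE
  -- is the corresponding controlled operation, and each `F r` is an isometry.
  let F : List Bool → Basis → QState := fun r =>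
    if h : ∃ C, DescribesUnitary (decodeTM (unaryDecode (block r a c₁)))
      (binaryValue (block r (a + c₁) c₂)) w C
    then fun b => CHFS.runGates (a + c₁ + c₂) h.choose (ket b.1 b.2)
    else fun b => ket (b.1.set (a + c₁ + c₂ + w) (!b.1.getD (a + c₁ + c₂ + w) false)) b.2
  have hF : ∀ r, IsoOn (F r) L L := by
    intro r
    simp only [F]
    split_ifs
    · exact IsoOn.runGates _ _ _
    · exact IsoOn.not _ _
  have hop : ∀ b : Basis, b.1.length = L →
      CHFS.qpspaceOp a c₁ c₂ w b = F (b.1.take (a + c₁ + c₂)) b := by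
    rintro ⟨s, e⟩ hs
    simp only at hs
    have h1 : block (s.take (a + c₁ + c₂)) a c₁ = block s a c₁ := by
      rw [block_eq_drop_take, block_eq_drop_take, List.take_take, min_eq_left (by omega)]
    have h2 : block (s.take (a + c₁ + c₂)) (a + c₁) c₂ = block s (a + c₁) c₂ := by
      rw [block_eq_drop_take, block_eq_drop_take, List.take_take, min_eq_left (by omega)]
    simp only [CHFS.qpspaceOp, F, h1, h2]
    rw [if_pos (by omega)]
    split_ifs <;> rfl
  refine IsoOn.of_key (fun b => b.1.take (a + c₁ + c₂)) (fun b => b.1.take (a + c₁ + c₂)) ?_ ?_ ?_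
  · intro b hb
    rw [hop b hb]
    exact (hF _).mem b hb
  · intro b hb b' hb'
    rw [hop b hb] at hb'
    simp only [F] at hb'
    split_ifs at hb'
    · exact take_eq_of_mem_support_runGates _ _ hb'
    · have := Finsupp.support_single_subset hb'
      simp only [Finset.mem_singleton] at this
      rw [this, List.take_set_of_le (by omega)]
  · intro b b' hb hb' hk
    rw [hop b hb, hop b' hb', hk]
    exact (hF _).inner b b' hb hb'

/-- The length `L'` is chosen before `Φ` and `Ψ`, so that states arising from different oracles lie
in the same `lenSpace` and can be subtracted. -/
theorem Instr.isoOn (ℓ : ℕ → ℕ) (S : Setting) (m n : ℕ) (I : Instr) (L : ℕ) :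
    ∃ L', ∀ (Φ : StateFamily ℓ) (Ψ : (Fin m → Bool) → PureState n),
      IsoOn (I.op S Φ (haarOracle S.access m n Ψ)) L L' := by
  cases I with
  | gate g => exact ⟨L, fun _ _ => g.isoOn 0 L⟩
  | alloc c =>
    refine ⟨L + c, fun _ _ => IsoOn.of_single (c := fun _ => 1)
      (σ := fun b => (b.1 ++ List.replicate c false, b.2)) (fun _ _ => rfl) (by simp)
      (fun b hb => by simp [hb]) ?_⟩
    rintro ⟨s, e⟩ ⟨s', e'⟩ - - h
    simpa using h
  | chfs a d =>
    obtain ⟨model, acc, q⟩ := S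
    cases model with
    | isometry =>
      obtain ⟨L', h⟩ := IsoOn.isometryOp ℓ acc a d L
      exact ⟨L', fun Φ _ => h Φ⟩
    | unitary => exact ⟨L, fun Φ _ => IsoOn.unitaryOp Φ acc a d L⟩
  | qpspace a c₁ c₂ w =>
    refine ⟨L, fun _ _ => ?_⟩
    simp only [Instr.op]
    split_ifs
    · exact IsoOn.qpspaceOp a c₁ c₂ w L
    · exact IsoOn.refl
  | gen a =>
    obtain ⟨L', h⟩ := IsoOn.haarOracle S.access m n a L
    exact ⟨L', fun _ Ψ => h Ψ⟩

/-! ### Acceptance probabilities -/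

theorem run_cons {ℓ : ℕ → ℕ} (S : Setting) (Φ : StateFamily ℓ) (G : ℕ → Basis → QState) (I : Instr)
    (C : Circuit) (ψ : QState) :
    run S Φ G (I :: C) ψ = run S Φ G C (applyOp (I.op S Φ G) ψ) := rfl

theorem run_sub {ℓ : ℕ → ℕ} (S : Setting) (Φ : StateFamily ℓ) (G : ℕ → Basis → QState)
    (C : Circuit) (ψ φ : QState) :
    run S Φ G C (ψ - φ) = run S Φ G C ψ - run S Φ G C φ := by
  induction C generalizing ψ φ with
  | nil => rfl
  | cons I C ih => simp only [run_cons, applyOp_sub, ih]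

theorem norm_vec_run {ℓ : ℕ → ℕ} (S : Setting) (m n : ℕ) (Φ : StateFamily ℓ)
    (Ψ : (Fin m → Bool) → PureState n) (C : Circuit) {L : ℕ} {ψ : QState} (hψ : ψ ∈ lenSpace L) :
    ‖vec (run S Φ (haarOracle S.access m n Ψ) C ψ)‖ = ‖vec ψ‖ := by
  induction C generalizing L ψ with
  | nil => rfl
  | cons I C ih =>
    obtain ⟨L', hI⟩ := I.isoOn ℓ S m n L
    rw [run_cons, ih ((hI Φ Ψ).applyOp_mem hψ), (hI Φ Ψ).norm_applyOp hψ]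

theorem norm_vec_ket (s : List Bool) (e : List (List Bool)) : ‖vec (ket s e)‖ = 1 := by
  have : ‖vec (ket s e)‖ ^ 2 = 1 := by
    rw [norm_sq_vec, ket, Finsupp.sum_single_index] <;> simp
  exact (pow_eq_one_iff_of_nonneg (norm_nonneg _) two_ne_zero).1 this

theorem norm_vec_filter_le (p : Basis → Prop) [DecidablePred p] (ψ : QState) :
    ‖vec (ψ.filter p)‖ ≤ ‖vec ψ‖ := by
  refine le_of_sq_le_sq ?_ (norm_nonneg _)
  rw [norm_sq_vec, norm_sq_vec, Finsupp.sum, Finsupp.sum, Finsupp.support_filter]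
  calc ∑ b ∈ ψ.support with p b, ‖(ψ.filter p) b‖ ^ 2 = ∑ b ∈ ψ.support with p b, ‖ψ b‖ ^ 2 :=
        Finset.sum_congr rfl fun b hb => by
          rw [Finsupp.filter_apply_pos _ _ (Finset.mem_filter.1 hb).2]
    _ ≤ _ := Finset.sum_le_sum_of_subset_of_nonneg (Finset.filter_subset _ _)
        fun _ _ _ => sq_nonneg _

theorem acceptProb_eq (ψ : QState) :
    acceptProb ψ = ‖vec (ψ.filter fun b => b.1.head? = some true)‖ ^ 2 := by
  rw [norm_sq_vec, acceptProb, Finsupp.sum, Finsupp.sum, Finsupp.support_filter,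
    Finset.sum_filter]
  refine Finset.sum_congr rfl fun b _ => ?_
  split_ifs with h
  · rw [Finsupp.filter_apply_pos (fun b : Basis => b.1.head? = some true) _ h]
  · rfl

theorem acceptProb_nonneg (ψ : QState) : 0 ≤ acceptProb ψ := by
  rw [acceptProb_eq]; positivity

theorem acceptProb_le (ψ : QState) : acceptProb ψ ≤ ‖vec ψ‖ ^ 2 := by
  rw [acceptProb_eq]
  gcongr
  exact norm_vec_filter_le _ _

/-- Acceptance is the squared norm of a projection; factor the difference of squares and use that
projections do not increase norms. -/
theorem abs_acceptProb_sub_le (ψ φ : QState) :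
    |acceptProb ψ - acceptProb φ| ≤ ‖vec ψ - vec φ‖ * (‖vec ψ‖ + ‖vec φ‖) := by
  rw [acceptProb_eq, acceptProb_eq, sq_sub_sq, abs_mul, mul_comm]
  gcongr
  · refine (abs_norm_sub_norm_le _ _).trans ?_
    rw [← map_sub, ← map_sub]
    have h := norm_vec_filter_le (fun b => b.1.head? = some true) (ψ - φ)
    rwa [Finsupp.filter_sub] at h
  · rw [abs_of_nonneg (by positivity)]
    gcongr <;> exact norm_vec_filter_le _ _

/-! ### Reprogramming the CHFS oracle on a random block -/

theorem sum_norm_vec_filter_sq_le {ι : Type*} [Fintype ι] [DecidableEq ι] (ψ : QState)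
    (key : Basis → Option ι) :
    ∑ k, ‖vec (ψ.filter fun b => key b = some k)‖ ^ 2 ≤ ‖vec ψ‖ ^ 2 := by
  simp only [norm_sq_vec, Finsupp.sum, Finsupp.support_filter, Finset.sum_filter]
  rw [Finset.sum_comm]
  refine Finset.sum_le_sum fun b _ => ?_
  calc ∑ k, (if key b = some k then ‖(ψ.filter fun b => key b = some k) b‖ ^ 2 else 0)
      = ∑ k, if key b = some k then ‖ψ b‖ ^ 2 else 0 :=
        Finset.sum_congr rfl fun k _ => by
          split_ifs with h
          · rw [Finsupp.filter_apply_pos (fun b => key b = some k) _ h]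
          · rfl
    _ ≤ ‖ψ b‖ ^ 2 := by
      cases h : key b with
      | none => simp
      | some j => simp [Finset.sum_ite_eq]

/-- The components with different keys are orthogonal, so Cauchy–Schwarz applies. This is the source
of the square root of the number of keys in the security bound. -/
theorem sum_norm_vec_filter_le {ι : Type*} [Fintype ι] [DecidableEq ι] (ψ : QState)
    (key : Basis → Option ι) :
    ∑ k, ‖vec (ψ.filter fun b => key b = some k)‖ ≤ √(Fintype.card ι) * ‖vec ψ‖ := by
  refine le_of_sq_le_sq ?_ (by positivity)
  rw [mul_pow, Real.sq_sqrt (Nat.cast_nonneg _)]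
  refine (sq_sum_le_card_mul_sum_sq (s := Finset.univ)).trans ?_
  rw [Finset.card_univ]
  gcongr
  exact sum_norm_vec_filter_sq_le ψ key

/-- On one basis state an instruction looks at no more than one of the CHFS states. -/
theorem Instr.op_congr {ℓ : ℕ → ℕ} (S : Setting) (G : ℕ → Basis → QState) (I : Instr) :
    (∀ Φ Φ' : StateFamily ℓ, I.op S Φ G = I.op S Φ' G) ∨
    ∃ x : Basis → List Bool, ∀ (Φ Φ' : StateFamily ℓ) (b : Basis), Φ (x b) = Φ' (x b) →
      I.op S Φ G b = I.op S Φ' G b := by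
  cases I with
  | chfs a d =>
    refine .inr ⟨fun b => block b.1 a d, fun Φ Φ' b h => ?_⟩
    obtain ⟨model, acc, q⟩ := S
    cases model <;> simp only [Instr.op, isometryOp, unitaryOp] <;> simp only at h <;> rw [h]
  | _ => exact .inl fun _ _ => rfl

/-- The two oracles differ only on the component of `ψ` that queries block `k`. Both are isometries
there, so the difference costs at most twice the norm of that component. -/
theorem sum_norm_vec_op_sub_le {ℓ : ℕ → ℕ} {ι : Type*} [Fintype ι] [DecidableEq ι] (S : Setting)
    (m n : ℕ) (Ψ : (Fin m → Bool) → PureState n) (Φ : StateFamily ℓ) (Φ' : ι → StateFamily ℓ)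
    (key : List Bool → Option ι) (hΦ : ∀ k x, key x ≠ some k → Φ' k x = Φ x) (I : Instr) {L : ℕ}
    {ψ : QState} (hψ : ψ ∈ lenSpace L) :
    ∑ k, ‖vec (applyOp (I.op S (Φ' k) (haarOracle S.access m n Ψ)) ψ -
        applyOp (I.op S Φ (haarOracle S.access m n Ψ)) ψ)‖ ≤
      2 * √(Fintype.card ι) * ‖vec ψ‖ := by
  obtain ⟨L', hI⟩ := I.isoOn ℓ S m n L
  rcases I.op_congr (ℓ := ℓ) S (haarOracle S.access m n Ψ) with h | ⟨x, hx⟩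
  · simp only [h _ Φ, sub_self, map_zero, norm_zero, Finset.sum_const_zero]
    positivity
  have hk : ∀ k, ‖vec (applyOp (I.op S (Φ' k) (haarOracle S.access m n Ψ)) ψ -
        applyOp (I.op S Φ (haarOracle S.access m n Ψ)) ψ)‖ ≤
      2 * ‖vec (ψ.filter fun b => key (x b) = some k)‖ := by
    intro k
    have hsplit : applyOp (I.op S (Φ' k) (haarOracle S.access m n Ψ)) ψ -
        applyOp (I.op S Φ (haarOracle S.access m n Ψ)) ψ =
      applyOp (I.op S (Φ' k) (haarOracle S.access m n Ψ)) (ψ.filter fun b => key (x b) = some k) -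
        applyOp (I.op S Φ (haarOracle S.access m n Ψ)) (ψ.filter fun b => key (x b) = some k) := by
      have h0 := Finsupp.filter_add_filter_not ψ fun b => key (x b) = some k
      conv_lhs => rw [← h0]
      rw [applyOp_add, applyOp_add, applyOp_congr
        (ψ := ψ.filter fun b => ¬ key (x b) = some k) (g := I.op S Φ (haarOracle S.access m n Ψ))]
      · abel
      · intro b hb
        rw [Finsupp.support_filter, Finset.mem_filter] at hb
        exact hx _ _ b (hΦ k _ hb.2)
    have hmem : (ψ.filter fun b => key (x b) = some k) ∈ lenSpace L := by
      rw [mem_lenSpace] at hψ ⊢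
      intro b hb
      rw [Finsupp.support_filter, Finset.mem_filter] at hb
      exact hψ b hb.1
    rw [hsplit, map_sub]
    refine (norm_sub_le _ _).trans_eq ?_
    rw [(hI _ Ψ).norm_applyOp hmem, (hI _ Ψ).norm_applyOp hmem, two_mul]
  calc _ ≤ ∑ k, 2 * ‖vec (ψ.filter fun b => key (x b) = some k)‖ := Finset.sum_le_sum fun k _ => hk k
    _ ≤ _ := by
      rw [← Finset.mul_sum, mul_assoc]
      gcongr
      exact sum_norm_vec_filter_le ψ fun b => key (x b)

/-- The hybrid argument: changing the CHFS states on one of `K` disjoint sets of inputs changes the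
final state of a circuit only a little on average. -/
theorem sum_norm_vec_run_sub_le {ℓ : ℕ → ℕ} {ι : Type*} [Fintype ι] [DecidableEq ι] (S : Setting)
    (m n : ℕ) (Ψ : (Fin m → Bool) → PureState n) (Φ : StateFamily ℓ) (Φ' : ι → StateFamily ℓ)
    (key : List Bool → Option ι) (hΦ : ∀ k x, key x ≠ some k → Φ' k x = Φ x) (C : Circuit) {L : ℕ}
    {ψ : QState} (hψ : ψ ∈ lenSpace L) :
    ∑ k, ‖vec (run S (Φ' k) (haarOracle S.access m n Ψ) C ψ) -
        vec (run S Φ (haarOracle S.access m n Ψ) C ψ)‖ ≤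
      2 * C.length * √(Fintype.card ι) * ‖vec ψ‖ := by
  induction C generalizing L ψ with
  | nil => simp [run]
  | cons I C ih =>
    obtain ⟨L', hI⟩ := I.isoOn ℓ S m n L
    have h1 := ih ((hI Φ Ψ).applyOp_mem hψ)
    rw [(hI Φ Ψ).norm_applyOp hψ] at h1
    have h2 := sum_norm_vec_op_sub_le S m n Ψ Φ Φ' key hΦ I hψ
    -- The intermediate hybrid runs `I` with `Φ` and the rest with `Φ' k`. The state passed to the
    -- induction hypothesis thus comes from `Φ` alone and is the same for all `k`, as the sum over
    -- `k` requires.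
    have h3 : ∀ k, ‖vec (run S (Φ' k) (haarOracle S.access m n Ψ) (I :: C) ψ) -
        vec (run S Φ (haarOracle S.access m n Ψ) (I :: C) ψ)‖ ≤
      ‖vec (applyOp (I.op S (Φ' k) (haarOracle S.access m n Ψ)) ψ -
        applyOp (I.op S Φ (haarOracle S.access m n Ψ)) ψ)‖ +
      ‖vec (run S (Φ' k) (haarOracle S.access m n Ψ) C
          (applyOp (I.op S Φ (haarOracle S.access m n Ψ)) ψ)) -
        vec (run S Φ (haarOracle S.access m n Ψ) C
          (applyOp (I.op S Φ (haarOracle S.access m n Ψ)) ψ))‖ := by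
      intro k
      rw [← norm_vec_run S m n (Φ' k) Ψ C (Submodule.sub_mem _ ((hI (Φ' k) Ψ).applyOp_mem hψ)
        ((hI Φ Ψ).applyOp_mem hψ)), run_sub, map_sub, run_cons, run_cons]
      exact norm_sub_le_norm_sub_add_norm_sub _ _ _
    calc _ ≤ _ := Finset.sum_le_sum fun k _ => h3 k
      _ ≤ 2 * √(Fintype.card ι) * ‖vec ψ‖ + 2 * C.length * √(Fintype.card ι) * ‖vec ψ‖ := by
        rw [Finset.sum_add_distrib]
        exact add_le_add h2 h1
      _ = _ := by
        push_cast [List.length_cons]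
        ring

/-- The acceptance probability of the circuit `A` with access to `Φ` and to `|x⟩ ↦ |x⟩|ψ_x⟩`. -/
def haarAccept {ℓ : ℕ → ℕ} (S : Setting) (m n : ℕ) (A : Circuit) (Φ : StateFamily ℓ)
    (Ψ : (Fin m → Bool) → PureState n) : ℝ :=
  acceptProb (run S Φ (haarOracle S.access m n Ψ) A (ket [] []))

theorem haarAccept_nonneg {ℓ : ℕ → ℕ} (S : Setting) (m n : ℕ) (A : Circuit) (Φ : StateFamily ℓ)
    (Ψ : (Fin m → Bool) → PureState n) : 0 ≤ haarAccept S m n A Φ Ψ := acceptProb_nonneg _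

theorem haarAccept_le_one {ℓ : ℕ → ℕ} (S : Setting) (m n : ℕ) (A : Circuit) (Φ : StateFamily ℓ)
    (Ψ : (Fin m → Bool) → PureState n) : haarAccept S m n A Φ Ψ ≤ 1 := by
  refine (acceptProb_le _).trans_eq ?_
  rw [norm_vec_run S m n Φ Ψ A (ket_mem_lenSpace [] []), norm_vec_ket, one_pow]

theorem sum_abs_haarAccept_sub_le {ℓ : ℕ → ℕ} {ι : Type*} [Fintype ι] [DecidableEq ι] (S : Setting)
    (m n : ℕ) (A : Circuit) (Ψ : (Fin m → Bool) → PureState n) (Φ : StateFamily ℓ)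
    (Φ' : ι → StateFamily ℓ) (key : List Bool → Option ι)
    (hΦ : ∀ k x, key x ≠ some k → Φ' k x = Φ x) :
    ∑ k, |haarAccept S m n A (Φ' k) Ψ - haarAccept S m n A Φ Ψ| ≤
      4 * A.length * √(Fintype.card ι) := by
  have h := sum_norm_vec_run_sub_le S m n Ψ Φ Φ' key hΦ A (ket_mem_lenSpace [] [])
  calc _ ≤ ∑ k, ‖vec (run S (Φ' k) (haarOracle S.access m n Ψ) A (ket [] [])) -
        vec (run S Φ (haarOracle S.access m n Ψ) A (ket [] []))‖ * 2 := by
        refine Finset.sum_le_sum fun k _ => (abs_acceptProb_sub_le _ _).trans_eq ?_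
        rw [norm_vec_run S m n _ Ψ A (ket_mem_lenSpace [] []),
          norm_vec_run S m n _ Ψ A (ket_mem_lenSpace [] []), norm_vec_ket]
        norm_num
    _ ≤ _ := by
      rw [← Finset.sum_mul]
      rw [norm_vec_ket] at h
      linarith

/-! ### Renaming the environment -/

/-- The environment register is relabelled by `ι`. -/
def mapEnv (ι : List (List Bool) → List (List Bool)) : QState →ₗ[ℂ] QState :=
  Finsupp.lmapDomain ℂ ℂ (Prod.map id ι)

@[simp]
theorem mapEnv_ket (ι : List (List Bool) → List (List Bool)) (s : List Bool) (e : List (List Bool)) :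
    mapEnv ι (ket s e) = ket s (ι e) := by
  simp [mapEnv, ket]

theorem mapEnv_appendState (ι : List (List Bool) → List (List Bool)) {n : ℕ} (φ : PureState n)
    (s : List Bool) (e : List (List Bool)) :
    mapEnv ι (appendState φ s e) = appendState φ s (ι e) := by
  simp [appendState]

theorem mapEnv_swapState (ι : List (List Bool) → List (List Bool)) {n : ℕ} (φ : PureState n) (c : ℕ)
    (s : List Bool) (e : List (List Bool)) :
    mapEnv ι (swapState φ c s e) = swapState φ c s (ι e) := by
  simp [swapState]

/-- The relabelling may change from `ι` to `ι'`, since a query can add records. Agreement is asked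
only on the support because it will be known only for a fixed number of wires. -/
theorem applyOp_mapEnv {f f' : Basis → QState} {ι ι' : List (List Bool) → List (List Bool)}
    {ψ : QState} (h : ∀ b ∈ ψ.support, f' (b.1, ι b.2) = mapEnv ι' (f b)) :
    applyOp f' (mapEnv ι ψ) = mapEnv ι' (applyOp f ψ) := by
  simp only [applyOp, mapEnv, Finsupp.lmapDomain_apply, Finsupp.linearCombination_mapDomain]
  simp only [Finsupp.linearCombination_apply, ← Finsupp.lmapDomain_apply ℂ ℂ, map_finsuppSum,
    map_smul]
  exact Finsupp.sum_congr fun b hb => by rw [← mapEnv, ← h b hb]; rfl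

theorem Gate.op_mapEnv (g : Gate) (o : ℕ) (ι : List (List Bool) → List (List Bool)) (s : List Bool)
    (e : List (List Bool)) : g.op o (s, ι e) = mapEnv ι (g.op o (s, e)) := by
  cases g <;> simp only [Gate.op] <;> split_ifs <;> simp

theorem runGates_mapEnv (o : ℕ) (C : List Gate) (ι : List (List Bool) → List (List Bool)) (ψ : QState) :
    runGates o C (mapEnv ι ψ) = mapEnv ι (runGates o C ψ) := by
  induction C generalizing ψ with
  | nil => rfl
  | cons g C ih =>
    simp only [runGates, List.foldl_cons] at ih ⊢
    rw [applyOp_mapEnv (f := g.op o) fun b _ => g.op_mapEnv o ι b.1 b.2, ih]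

theorem qpspaceOp_mapEnv (a c₁ c₂ w : ℕ) (ι : List (List Bool) → List (List Bool)) (s : List Bool)
    (e : List (List Bool)) : qpspaceOp a c₁ c₂ w (s, ι e) = mapEnv ι (qpspaceOp a c₁ c₂ w (s, e)) := by
  simp only [qpspaceOp]
  split_ifs
  · rw [← mapEnv_ket, runGates_mapEnv]
  · simp
  · simp

theorem acceptProb_mapEnv {ι : List (List Bool) → List (List Bool)} (hι : Function.Injective ι)
    (ψ : QState) : acceptProb (mapEnv ι ψ) = acceptProb ψ := by
  simp only [acceptProb, mapEnv, Finsupp.lmapDomain_apply]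
  rw [Finsupp.sum_mapDomain_index_inj (Function.injective_id.prodMap hι)]
  rfl

/-! ### The generator as an oracle -/

theorem isometryOp_of_le {ℓ : ℕ → ℕ} (Φ : StateFamily ℓ) (acc : Access) {a d : ℕ} {s : List Bool}
    (h : a + d ≤ s.length) (e : List (List Bool)) :
    isometryOp Φ acc a d (s, e) =
      appendState (Φ (block s a d)) s (acc.record (block s a d) e) := by
  simp only [isometryOp]
  rw [if_pos h]
  rfl

theorem unitaryOp_of_le {ℓ : ℕ → ℕ} (Φ : StateFamily ℓ) (acc : Access) {a d : ℕ} {s : List Bool}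
    (h : a + d + (ℓ d + 1) ≤ s.length) (e : List (List Bool)) :
    unitaryOp Φ acc a d (s, e) =
      swapState (Φ (block s a d)) (a + d) s (acc.record (block s a d) e) := by
  simp only [unitaryOp]
  rw [if_pos h]
  rfl

theorem haarOracle_of_le (acc : Access) {m n : ℕ} (Ψ : (Fin m → Bool) → PureState n) {a : ℕ}
    {s : List Bool} (h : a + m ≤ s.length) (e : List (List Bool)) :
    haarOracle acc m n Ψ a (s, e) =
      appendState (Ψ fun i => s.getD (a + i) false) s (acc.record (block s a m) e) := by
  simp only [haarOracle]
  rw [if_pos h]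
  rfl

theorem swapEntry_zero {n : ℕ} (φ : PureState n) (z : Fin (n + 1) → Bool) :
    swapEntry φ z (fun _ => false) = if z (Fin.last n) then φ.1 (fun i => z i.castSucc) else 0 := by
  have h2 : 2 * ((1 / √2 : ℝ) : ℂ) * ((1 / √2 : ℝ) : ℂ) = 1 := by
    rw [mul_assoc, ← Complex.ofReal_mul, div_mul_div_comm, Real.mul_self_sqrt (by norm_num)]
    norm_num
  simp only [swapEntry, minusVec, if_true, Bool.false_eq_true, if_false, sub_zero, mul_one,
    Complex.conj_ofReal]
  linear_combination (-(if z = fun _ => false then 1 else 0) +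
    (if z (Fin.last n) then φ.1 (fun i => z i.castSucc) else 0)) * h2

/-- The reflection `S` takes `|0⋯0⟩` to `|φ⟩|1⟩`. -/
theorem swapState_zero {n : ℕ} (φ : PureState n) (s r : List Bool) (e : List (List Bool)) :
    swapState φ s.length (s ++ List.replicate (n + 1) false ++ r) e =
      ∑ y : Fin n → Bool, φ.1 y • ket (s ++ List.ofFn y ++ true :: r) e := by
  have h0 : (fun i : Fin (n + 1) => (s ++ List.replicate (n + 1) false ++ r).getD (s.length + i) false) =
      fun _ => false := by
    funext i
    have := i.2
    simp [List.getElem?_append, show (i : ℕ) ≤ n by omega]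
  have ht : (s ++ List.replicate (n + 1) false ++ r).take s.length = s := by simp
  have hd : (s ++ List.replicate (n + 1) false ++ r).drop (s.length + (n + 1)) = r := by
    rw [List.drop_left' (by simp)]
  simp only [swapState, h0, ht, hd, swapEntry_zero]
  rw [← (Fin.snocEquiv fun _ : Fin (n + 1) => Bool).sum_comp, Fintype.sum_prod_type]
  simp only [Fintype.sum_bool, Fin.snocEquiv_apply, Fin.snoc_last, Fin.snoc_castSucc, if_true,
    Bool.false_eq_true, if_false, zero_smul, Finset.sum_const_zero, add_zero]
  refine Finset.sum_congr rfl fun y _ => ?_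
  rw [List.ofFn_succ']
  simp [List.concat_eq_append]

/-- The wires after the output register of the generator. -/
def garbage (model : Model) (s : ℕ) : List Bool :=
  match model with
  | .isometry => []
  | .unitary => true :: List.replicate s false

theorem runGen_prfsGen {ℓ : ℕ → ℕ} (S : Setting) (Φ : StateFamily ℓ) (s κ m : ℕ) {k x : List Bool}
    (hk : k.length = κ) (hx : x.length = m) (e : List (List Bool)) :
    runGen S Φ (prfsGen S.model s (ℓ (κ + m)) κ m) k x e =
      ∑ y : Fin (ℓ (k ++ x).length) → Bool, (Φ (k ++ x)).1 y •
        ket (k ++ x ++ List.ofFn y ++ garbage S.model s) (S.access.record (k ++ x) e) := by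
  obtain ⟨model, acc, q⟩ := S
  have hb : ∀ r, block (k ++ x ++ r) 0 (κ + m) = k ++ x := by
    intro r
    simp only [block, List.drop_zero]
    exact List.take_left' (by simp [hk, hx])
  cases model with
  | isometry =>
    have hb0 := hb []
    rw [List.append_nil] at hb0
    simp only [runGen, prfsGen, run, List.foldl_cons, List.foldl_nil, applyOp_ket, Instr.op,
      garbage, List.append_nil]
    rw [isometryOp_of_le Φ acc (by simp [hk, hx]), hb0]
    rfl
  | unitary =>
    simp only [runGen, prfsGen, run, List.foldl_cons, List.foldl_nil, applyOp_ket, Instr.op]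
    have hlen : (k ++ x).length = κ + m := by simp [hk, hx]
    have hr : List.replicate (s + 1 + ℓ (κ + m)) false =
        List.replicate (ℓ (k ++ x).length + 1) false ++ List.replicate s false := by
      rw [← List.replicate_add, hlen]
      congr 1
      omega
    have hsw := swapState_zero (Φ (k ++ x)) (k ++ x) (List.replicate s false) (acc.record (k ++ x) e)
    rw [List.append_assoc, ← hr] at hsw
    rw [unitaryOp_of_le Φ acc (by simp [hk, hx]; omega), hb, zero_add, garbage, ← hsw]
    exact congrArg (fun c => swapState (Φ (k ++ x)) c _ _) hlen.symm

theorem generatesStates_prfsGen {ℓ : ℕ → ℕ} (S : Setting) (Φ : StateFamily ℓ) (s κ m : ℕ) :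
    GeneratesStates S Φ κ m (ℓ (κ + m)) (prfsGen S.model s (ℓ (κ + m)) κ m) := by
  intro k x hk hx b hb
  rw [runGen_prfsGen S Φ s κ m hk hx] at hb
  obtain ⟨y, -, hy⟩ := Finsupp.mem_support_finsetSum _ hb
  have := Finsupp.support_single_subset (Finsupp.support_smul hy)
  simp only [Finset.mem_singleton] at this
  subst this
  constructor
  · simp [hk, hx]
    omega
  · simp only [block, List.append_assoc]
    rw [List.drop_left' hk, List.take_left' hx]

/-- The discarded wires end in basis states that do not depend on the output bits `y`. Discarding
them therefore does not disturb the superposition in the output register. -/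
theorem genOracle_prfsGen {ℓ : ℕ → ℕ} (S : Setting) (Φ : StateFamily ℓ) (c κ m : ℕ) {k : List Bool}
    (hk : k.length = κ) (a : ℕ) {s : List Bool} (hs : a + m ≤ s.length) (e : List (List Bool)) :
    genOracle S Φ m (ℓ (κ + m)) (prfsGen S.model c (ℓ (κ + m)) κ m) k a (s, e) =
      appendState (Φ (k ++ block s a m)) s (k :: garbage S.model c ::
        S.access.record (k ++ block s a m) (S.access.record (block s a m) e)) := by
  simp only [genOracle]
  rw [if_pos hs, runGen_prfsGen S Φ c κ m hk (length_block hs), Finsupp.mapDomain_finsetSum]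
  simp only [appendState, Finsupp.mapDomain_smul, ket, Finsupp.mapDomain_single]
  refine Finset.sum_congr rfl fun y _ => ?_
  congr 2
  generalize hx : block s a m = x at *
  have hxl : x.length = m := by rw [← hx, length_block hs]
  have hy : (List.ofFn y).length = ℓ (κ + m) := by simp [hk, hxl]
  refine Prod.ext ?_ ?_
  · simp only [block]
    rw [List.append_assoc, List.drop_left' (by simp [hxl]), List.take_left' hy]
  · simp only [List.append_assoc, List.take_left' (rfl : k.length = k.length), List.cons.injEq,
      true_and, and_true]
    rw [← List.append_assoc, ← List.append_assoc, List.drop_left' (by simp [hxl, hk]; omega)]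

/-! ### The real experiment as an ideal one -/

/-- A state on `a = b` qubits. -/
def PureState.cast {a b : ℕ} (h : a = b) (φ : PureState a) : PureState b := h ▸ φ

theorem appendState_cast {a b : ℕ} (h : a = b) (φ : PureState a) (s : List Bool)
    (e : List (List Bool)) : appendState (PureState.cast h φ) s e = appendState φ s e := by
  subst h; rfl

/-- The CHFS states for the inputs that start with the key `k`. -/
def keyBlock {ℓ : ℕ → ℕ} {κ m : ℕ} (k : Fin κ → Bool) (Φ : StateFamily ℓ) (z : Fin m → Bool) :
    PureState (ℓ (κ + m)) :=
  PureState.cast (by simp) (Φ (List.ofFn k ++ List.ofFn z))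

theorem haarOracle_keyBlock {ℓ : ℕ → ℕ} (acc : Access) {κ m : ℕ} (k : Fin κ → Bool)
    (Φ : StateFamily ℓ) (a : ℕ) {s : List Bool} (hs : a + m ≤ s.length) (e : List (List Bool)) :
    haarOracle acc m (ℓ (κ + m)) (keyBlock k Φ) a (s, e) =
      appendState (Φ (List.ofFn k ++ block s a m)) s (acc.record (block s a m) e) := by
  rw [haarOracle_of_le acc _ hs, keyBlock, appendState_cast, ← block_eq_ofFn hs]

/-- In the classical case the real query records more than the ideal one, but all extra entries are
functions of the recorded `x`, so an injection can insert them. In the quantum case only the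
constant prefix `p` is added. -/
theorem Access.exists_lift (acc : Access) {ι : List (List Bool) → List (List Bool)}
    (hι : Function.Injective ι) (g : List Bool → List Bool) (p : List (List Bool)) :
    ∃ ι', Function.Injective ι' ∧ ∀ x e, ι' (acc.record x e) =
      p ++ acc.record (g x) (acc.record x (ι e)) := by
  cases acc with
  | quantum =>
    exact ⟨fun e => p ++ ι e, fun e e' h => hι (List.append_cancel_left h), fun _ _ => rfl⟩
  | classical =>
    refine ⟨fun e => match e with
      | [] => []
      | x :: e => p ++ g x :: x :: ι e, ?_, fun _ _ => rfl⟩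
    rintro (_ | ⟨x, e⟩) (_ | ⟨x', e'⟩) h
    · rfl
    · simp at h
    · simp at h
    · have := List.append_cancel_left h
      simp only [List.cons.injEq] at this
      rw [this.2.1, hι this.2.2]

theorem Access.exists_lift' (acc : Access) {ι : List (List Bool) → List (List Bool)}
    (hι : Function.Injective ι) :
    ∃ ι', Function.Injective ι' ∧ ∀ x e, ι' (acc.record x e) = acc.record x (ι e) := by
  cases acc with
  | quantum => exact ⟨ι, hι, fun _ _ => rfl⟩
  | classical =>
    refine ⟨fun e => match e with
      | [] => []
      | x :: e => x :: ι e, ?_, fun _ _ => rfl⟩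
    rintro (_ | ⟨x, e⟩) (_ | ⟨x', e'⟩) h
    · rfl
    · simp at h
    · simp at h
    · simp only [List.cons.injEq] at h
      rw [h.1, hι h.2]

/-- The relabelling depends on the number `L` of wires: a query that does not fit does nothing and
leaves no record. -/
theorem Instr.op_genOracle {ℓ : ℕ → ℕ} (S : Setting) (Φ : StateFamily ℓ) (c : ℕ) {κ m : ℕ}
    (k : Fin κ → Bool) (I : Instr) (L : ℕ) {ι : List (List Bool) → List (List Bool)}
    (hι : Function.Injective ι) :
    ∃ ι', Function.Injective ι' ∧ ∀ s e, s.length = L →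
      I.op S Φ (genOracle S Φ m (ℓ (κ + m)) (prfsGen S.model c (ℓ (κ + m)) κ m) (List.ofFn k))
        (s, ι e) =
      mapEnv ι' (I.op S Φ (haarOracle S.access m (ℓ (κ + m)) (keyBlock k Φ)) (s, e)) := by
  cases I with
  | gate g => exact ⟨ι, hι, fun s e _ => g.op_mapEnv 0 ι s e⟩
  | alloc c => exact ⟨ι, hι, fun s e _ => by simp [Instr.op]⟩
  | qpspace a c₁ c₂ w =>
    refine ⟨ι, hι, fun s e _ => ?_⟩
    simp only [Instr.op]
    split_ifs
    · exact qpspaceOp_mapEnv a c₁ c₂ w ι s e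
    · simp
  | chfs a d =>
    obtain ⟨ι', hι', h⟩ := S.access.exists_lift' hι
    obtain ⟨model, acc, q⟩ := S
    cases model with
    | isometry =>
      by_cases hL : a + d ≤ L
      · refine ⟨ι', hι', fun s e hs => ?_⟩
        simp only [Instr.op]
        rw [isometryOp_of_le Φ acc (by omega), isometryOp_of_le Φ acc (by omega),
          mapEnv_appendState, h]
      · refine ⟨ι, hι, fun s e hs => ?_⟩
        simp only [Instr.op, isometryOp]
        rw [if_neg (by omega), if_neg (by omega), mapEnv_ket]
    | unitary =>
      by_cases hL : a + d + (ℓ d + 1) ≤ L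
      · refine ⟨ι', hι', fun s e hs => ?_⟩
        simp only [Instr.op]
        rw [unitaryOp_of_le Φ acc (by omega), unitaryOp_of_le Φ acc (by omega),
          mapEnv_swapState, h]
      · refine ⟨ι, hι, fun s e hs => ?_⟩
        simp only [Instr.op, unitaryOp]
        rw [if_neg (by omega), if_neg (by omega), mapEnv_ket]
  | gen a =>
    obtain ⟨ι', hι', h⟩ := S.access.exists_lift hι (fun x => List.ofFn k ++ x)
      [List.ofFn k, garbage S.model c]
    by_cases hL : a + m ≤ L
    · refine ⟨ι', hι', fun s e hs => ?_⟩
      simp only [Instr.op]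
      rw [genOracle_prfsGen S Φ c κ m (by simp) a (by omega),
        haarOracle_keyBlock S.access k Φ a (by omega), mapEnv_appendState, h]
      rfl
    · refine ⟨ι, hι, fun s e hs => ?_⟩
      simp only [Instr.op, genOracle, haarOracle]
      rw [if_neg (by omega), if_neg (by omega), mapEnv_ket]

theorem run_genOracle {ℓ : ℕ → ℕ} (S : Setting) (Φ : StateFamily ℓ) (c : ℕ) {κ m : ℕ}
    (k : Fin κ → Bool) (A : Circuit) {L : ℕ} {ψ : QState} (hψ : ψ ∈ lenSpace L)
    {ι : List (List Bool) → List (List Bool)} (hι : Function.Injective ι) :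
    ∃ ι', Function.Injective ι' ∧
      run S Φ (genOracle S Φ m (ℓ (κ + m)) (prfsGen S.model c (ℓ (κ + m)) κ m) (List.ofFn k)) A
        (mapEnv ι ψ) =
      mapEnv ι' (run S Φ (haarOracle S.access m (ℓ (κ + m)) (keyBlock k Φ)) A ψ) := by
  induction A generalizing L ψ ι with
  | nil => exact ⟨ι, hι, rfl⟩
  | cons I A ih =>
    obtain ⟨ι₁, hι₁, h⟩ := I.op_genOracle S Φ c (m := m) k L hι
    obtain ⟨L', hI⟩ := I.isoOn ℓ S m (ℓ (κ + m)) L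
    obtain ⟨ι₂, hι₂, h₂⟩ := ih ((hI Φ (keyBlock k Φ)).applyOp_mem hψ) hι₁
    refine ⟨ι₂, hι₂, ?_⟩
    rw [run_cons, run_cons, ← h₂, applyOp_mapEnv fun b hb => h b.1 b.2 (mem_lenSpace.1 hψ b hb)]

theorem realProb_prfsGen {ℓ : ℕ → ℕ} (S : Setting) (Φ : StateFamily ℓ) (c κ m : ℕ) (A : Circuit) :
    realProb S Φ κ m (ℓ (κ + m)) (prfsGen S.model c (ℓ (κ + m)) κ m) A =
      (∑ k : Fin κ → Bool, haarAccept S m (ℓ (κ + m)) A Φ (keyBlock k Φ)) / 2 ^ κ := by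
  have hid : mapEnv id (ket [] []) = ket [] [] := by simp
  refine congrArg (· / (2 : ℝ) ^ κ) (Finset.sum_congr rfl fun k _ => ?_)
  obtain ⟨ι, hι, h⟩ := run_genOracle S Φ c (m := m) k A (ket_mem_lenSpace [] [])
    Function.injective_id
  rw [hid] at h
  rw [haarAccept, h, acceptProb_mapEnv hι]

/-! ### Measurability of acceptance probabilities -/

/-- A random state whose support is contained in a fixed finite set and whose amplitudes are
measurable. -/
def MeasurableState {Ω : Type*} [MeasurableSpace Ω] (ψ : Ω → QState) : Prop :=
  ∃ F : Finset Basis, (∀ ω, (ψ ω).support ⊆ F) ∧ ∀ b, Measurable fun ω => ψ ω b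

namespace MeasurableState

variable {Ω : Type*} [MeasurableSpace Ω]

theorem const (φ : QState) : MeasurableState fun _ : Ω => φ :=
  ⟨φ.support, fun _ => subset_rfl, fun _ => measurable_const⟩

theorem add {ψ φ : Ω → QState} (hψ : MeasurableState ψ) (hφ : MeasurableState φ) :
    MeasurableState fun ω => ψ ω + φ ω := by
  obtain ⟨F, hF, hm⟩ := hψ
  obtain ⟨F', hF', hm'⟩ := hφ
  exact ⟨F ∪ F', fun ω => Finsupp.support_add.trans (Finset.union_subset_union (hF ω) (hF' ω)),
    fun b => (hm b).add (hm' b)⟩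

theorem smul {c : Ω → ℂ} {ψ : Ω → QState} (hc : Measurable c) (hψ : MeasurableState ψ) :
    MeasurableState fun ω => c ω • ψ ω := by
  obtain ⟨F, hF, hm⟩ := hψ
  exact ⟨F, fun ω => Finsupp.support_smul.trans (hF ω), fun b => hc.mul (hm b)⟩

theorem sum {ι : Type*} (s : Finset ι) {ψ : ι → Ω → QState} (h : ∀ i ∈ s, MeasurableState (ψ i)) :
    MeasurableState fun ω => ∑ i ∈ s, ψ i ω := by
  classical
  induction s using Finset.induction_on with
  | empty => simpa using const 0
  | insert i s hi ih =>
    simp only [Finset.sum_insert hi]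
    exact (h i (Finset.mem_insert_self i s)).add
      (ih fun j hj => h j (Finset.mem_insert_of_mem hj))

theorem applyOp {f : Ω → Basis → QState} {ψ : Ω → QState} (hf : ∀ b, MeasurableState fun ω => f ω b)
    (hψ : MeasurableState ψ) : MeasurableState fun ω => CHFS.applyOp (f ω) (ψ ω) := by
  obtain ⟨F, hF, hm⟩ := hψ
  -- The finite set `F` does not depend on `ω`, so the linear combination is a sum over a fixed
  -- index set.
  have : (fun ω => CHFS.applyOp (f ω) (ψ ω)) = fun ω => ∑ b ∈ F, ψ ω b • f ω b := by
    funext ω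
    rw [CHFS.applyOp, Finsupp.linearCombination_apply,
      Finsupp.sum_of_support_subset _ (hF ω) _ (by simp)]
  rw [this]
  exact sum F fun b _ => smul (hm b) (hf b)

theorem acceptProb {ψ : Ω → QState} (hψ : MeasurableState ψ) :
    Measurable fun ω => CHFS.acceptProb (ψ ω) := by
  obtain ⟨F, hF, hm⟩ := hψ
  have : (fun ω => CHFS.acceptProb (ψ ω)) = fun ω =>
      ∑ b ∈ F, if b.1.head? = some true then ‖ψ ω b‖ ^ 2 else 0 := by
    funext ω
    rw [CHFS.acceptProb, Finsupp.sum_of_support_subset _ (hF ω) _ (by simp)]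
  rw [this]
  refine Finset.measurable_sum F fun b _ => ?_
  split_ifs
  · exact (hm b).norm.pow_const 2
  · exact measurable_const

theorem appendState {n : ℕ} {φ : Ω → PureState n} (hφ : Measurable φ) (s : List Bool)
    (e : List (List Bool)) : MeasurableState fun ω => CHFS.appendState (φ ω) s e :=
  sum _ fun y _ => smul ((EuclideanSpace.proj (𝕜 := ℂ) y).continuous.measurable.comp
    (measurable_subtype_coe.comp hφ)) (const _)

theorem swapState {n : ℕ} {φ : Ω → PureState n} (hφ : Measurable φ) (c : ℕ) (s : List Bool)
    (e : List (List Bool)) : MeasurableState fun ω => CHFS.swapState (φ ω) c s e := by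
  have hm : ∀ z, Measurable fun ω => minusVec (φ ω) z := by
    intro z
    unfold minusVec
    refine measurable_const.mul (measurable_const.sub ?_)
    split_ifs
    · exact (EuclideanSpace.proj (𝕜 := ℂ) _).continuous.measurable.comp
        (measurable_subtype_coe.comp hφ)
    · exact measurable_const
  refine sum _ fun z _ => smul ?_ (const _)
  unfold swapEntry
  exact measurable_const.sub ((measurable_const.mul (hm _)).mul
    (Complex.continuous_conj.measurable.comp (hm _)))

end MeasurableState

theorem measurableState_op {ℓ : ℕ → ℕ} (S : Setting) (m n : ℕ) (I : Instr) (b : Basis) :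
    MeasurableState fun p : StateFamily ℓ × ((Fin m → Bool) → PureState n) =>
      I.op S p.1 (haarOracle S.access m n p.2) b := by
  obtain ⟨s, e⟩ := b
  have hΦ : ∀ x, Measurable fun p : StateFamily ℓ × ((Fin m → Bool) → PureState n) => p.1 x :=
    fun x => (measurable_pi_apply x).comp measurable_fst
  cases I with
  | chfs a d =>
    obtain ⟨model, acc, q⟩ := S
    cases model with
    | isometry =>
      by_cases h : a + d ≤ s.length
      · simp only [Instr.op, isometryOp_of_le _ acc h]
        exact .appendState (hΦ _) _ _
      · simp only [Instr.op, isometryOp, if_neg h]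
        exact .const _
    | unitary =>
      by_cases h : a + d + (ℓ d + 1) ≤ s.length
      · simp only [Instr.op, unitaryOp_of_le _ acc h]
        exact .swapState (hΦ _) _ _ _
      · simp only [Instr.op, unitaryOp, if_neg h]
        exact .const _
  | gen a =>
    by_cases h : a + m ≤ s.length
    · simp only [Instr.op, haarOracle_of_le S.access _ h]
      exact .appendState ((measurable_pi_apply fun i : Fin m => s.getD (a + i) false).comp
        measurable_snd) _ _
    · simp only [Instr.op, haarOracle, if_neg h]
      exact .const _
  | _ => exact .const _

theorem measurable_haarAccept {ℓ : ℕ → ℕ} (S : Setting) (m n : ℕ) (A : Circuit) :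
    Measurable fun p : StateFamily ℓ × ((Fin m → Bool) → PureState n) =>
      haarAccept S m n A p.1 p.2 := by
  refine MeasurableState.acceptProb ?_
  induction A using List.reverseRecOn with
  | nil => exact .const _
  | append_singleton A I ih =>
    simp only [run, List.foldl_append, List.foldl_cons, List.foldl_nil]
    exact .applyOp (measurableState_op S m n I) ih

/-! ### Resampling the states for one key -/

/-- Choosing each coordinate from one of two independent copies, by a rule depending only on the
index, keeps the coordinates independent with the same laws. On finite cylinders, the product of
measures splits according to `p`. -/
theorem measurePreserving_mix {ι : Type*} {X : ι → Type*} [∀ i, MeasurableSpace (X i)]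
    (μ : ∀ i, Measure (X i)) [∀ i, IsProbabilityMeasure (μ i)] (p : ι → Prop) [DecidablePred p] :
    MeasurePreserving (fun (q : (∀ i, X i) × (∀ i, X i)) i => if p i then q.2 i else q.1 i)
      ((Measure.infinitePi μ).prod (Measure.infinitePi μ)) (Measure.infinitePi μ) := by
  have hm : Measurable fun (q : (∀ i, X i) × (∀ i, X i)) i => if p i then q.2 i else q.1 i := by
    refine measurable_pi_lambda _ fun i => ?_
    split_ifs <;> fun_prop
  refine ⟨hm, Measure.eq_infinitePi μ fun s t ht => ?_⟩
  rw [Measure.map_apply hm (.pi s.countable_toSet fun i _ => ht i)]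
  have : (fun (q : (∀ i, X i) × (∀ i, X i)) i => if p i then q.2 i else q.1 i) ⁻¹' Set.pi s t =
      Set.pi (s.filter fun i => ¬ p i : Finset ι) t ×ˢ Set.pi (s.filter p : Finset ι) t := by
    ext ⟨q₁, q₂⟩
    simp only [Set.mem_preimage, Set.mem_pi, Set.mem_prod, Finset.coe_filter, Set.mem_ofPred_eq,
      Finset.mem_coe]
    constructor
    · exact fun h => ⟨fun i hi => by simpa [hi.2] using h i hi.1,
        fun i hi => by simpa [hi.2] using h i hi.1⟩
    · rintro ⟨h1, h2⟩ i hi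
      by_cases hp : p i
      · simpa [hp] using h2 i ⟨hi, hp⟩
      · simpa [hp] using h1 i ⟨hi, hp⟩
  rw [this, Measure.prod_prod, Measure.infinitePi_pi _ fun i _ => ht i,
    Measure.infinitePi_pi _ fun i _ => ht i, mul_comm, Finset.prod_filter_mul_prod_filter_not]

instance (ℓ : ℕ → ℕ) : IsProbabilityMeasure (chfsMeasure ℓ) := by
  unfold chfsMeasure; infer_instance

theorem PureState.measurePreserving_cast {a b : ℕ} (h : a = b) :
    MeasurePreserving (PureState.cast h) (haarState a) (haarState b) := by
  subst h
  exact MeasurePreserving.id _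

theorem PureState.cast_trans {a b c : ℕ} (h : a = b) (h' : b = c) (φ : PureState a) :
    PureState.cast h' (PureState.cast h φ) = PureState.cast (h.trans h') φ := by
  subst h h'; rfl

theorem StateFamily.cast_apply {ℓ : ℕ → ℕ} (Φ : StateFamily ℓ) {x y : List Bool} (h : x = y)
    (hl : ℓ x.length = ℓ y.length) : PureState.cast hl (Φ x) = Φ y := by
  subst h; rfl

/-- The strings `k ‖ z` are distinct, so a block consists of independent Haar states, just like the
ideal oracle. The casts only reconcile `ℓ` of a string length with `ℓ (κ + m)`. -/
theorem measurePreserving_keyBlock (ℓ : ℕ → ℕ) {κ m : ℕ} (k : Fin κ → Bool) :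
    MeasurePreserving (keyBlock (ℓ := ℓ) (m := m) k) (chfsMeasure ℓ)
      (Measure.pi fun _ => haarState (ℓ (κ + m))) := by
  have hinj : Function.Injective fun z : Fin m → Bool => List.ofFn k ++ List.ofFn z :=
    fun z z' h => List.ofFn_injective (List.append_cancel_left h)
  have hl : ∀ z : Fin m → Bool, ℓ (List.ofFn k ++ List.ofFn z).length = ℓ (κ + m) := by simp
  have h1 : MeasurePreserving (fun (Φ : StateFamily ℓ) (z : Fin m → Bool) =>
      Φ (List.ofFn k ++ List.ofFn z)) (chfsMeasure ℓ)
      (Measure.infinitePi fun z : Fin m → Bool => haarState (ℓ (List.ofFn k ++ List.ofFn z).length)) :=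
    ⟨by fun_prop, Measure.map_infinitePi_infinitePi_of_inj hinj⟩
  have h2 : MeasurePreserving (fun (Ψ : (z : Fin m → Bool) →
      PureState (ℓ (List.ofFn k ++ List.ofFn z).length)) z => PureState.cast (hl z) (Ψ z))
      (Measure.infinitePi fun z : Fin m → Bool => haarState (ℓ (List.ofFn k ++ List.ofFn z).length))
      (Measure.infinitePi fun _ => haarState (ℓ (κ + m))) := by
    have hc := fun z => PureState.measurePreserving_cast (hl z)
    refine ⟨measurable_pi_lambda _ fun z => (hc z).measurable.comp (measurable_pi_apply z), ?_⟩
    rw [Measure.infinitePi_map_pi _ fun z => (hc z).measurable]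
    congr 1
    funext z
    exact (hc z).map_eq
  rw [← Measure.infinitePi_eq_pi]
  exact h2.comp h1

/-- The key in an input of length `κ + m`. -/
def keyOf (κ m : ℕ) (x : List Bool) : Option (Fin κ → Bool) :=
  if x.length = κ + m then some fun i => x.getD i false else none

theorem eq_append_of_keyOf {κ m : ℕ} {x : List Bool} {k : Fin κ → Bool} (h : keyOf κ m x = some k) :
    x.length = κ + m ∧ x = List.ofFn k ++ List.ofFn fun i : Fin m => x.getD (κ + i) false := by
  unfold keyOf at h
  split_ifs at h with hx
  refine ⟨hx, ?_⟩
  have h1 := eq_take_append_ofFn_append_drop (s := x) (a := 0) (d := κ) (by omega)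
  have h2 := eq_take_append_ofFn_append_drop (s := x) (a := κ) (d := m) (by omega)
  simp only [Option.some.injEq] at h
  simp only [List.take_zero, List.nil_append, zero_add, h] at h1
  rw [List.drop_eq_nil_of_le (by omega), List.append_nil] at h2
  have h3 : x.take κ = List.ofFn k := by
    conv_lhs => rw [h1]
    exact List.take_left' (by simp)
  rw [h3] at h2
  exact h2

theorem keyOf_append {κ m : ℕ} (k : Fin κ → Bool) (z : Fin m → Bool) :
    keyOf κ m (List.ofFn k ++ List.ofFn z) = some k := by
  unfold keyOf
  rw [if_pos (by simp)]
  congr 1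
  funext i
  simp [List.getElem?_append]

/-- The states for the key `k` are replaced by `Ψ`. -/
def reprogram {ℓ : ℕ → ℕ} {κ m : ℕ} (k : Fin κ → Bool) (Ψ : (Fin m → Bool) → PureState (ℓ (κ + m)))
    (Φ : StateFamily ℓ) : StateFamily ℓ := fun x =>
  if h : keyOf κ m x = some k then
    PureState.cast (by rw [(eq_append_of_keyOf h).1]) (Ψ fun i => x.getD (κ + i) false)
  else Φ x

theorem reprogram_of_ne {ℓ : ℕ → ℕ} {κ m : ℕ} {k : Fin κ → Bool}
    (Ψ : (Fin m → Bool) → PureState (ℓ (κ + m))) (Φ : StateFamily ℓ) {x : List Bool}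
    (h : keyOf κ m x ≠ some k) : reprogram k Ψ Φ x = Φ x := dif_neg h

theorem keyBlock_reprogram {ℓ : ℕ → ℕ} {κ m : ℕ} (k : Fin κ → Bool)
    (Ψ : (Fin m → Bool) → PureState (ℓ (κ + m))) (Φ : StateFamily ℓ) :
    keyBlock k (reprogram k Ψ Φ) = Ψ := by
  funext z
  rw [keyBlock, reprogram, dif_pos (keyOf_append k z), PureState.cast_trans]
  have : (fun i : Fin m => (List.ofFn k ++ List.ofFn z).getD (κ + i) false) = z := by
    funext i
    simp
  rw [this]
  rfl

theorem keyBlock_reprogram_of_ne {ℓ : ℕ → ℕ} {κ m : ℕ} {k k' : Fin κ → Bool} (h : k' ≠ k)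
    (Ψ : (Fin m → Bool) → PureState (ℓ (κ + m))) (Φ : StateFamily ℓ) :
    keyBlock (m := m) k' (reprogram k Ψ Φ) = keyBlock k' Φ := by
  funext z
  rw [keyBlock, reprogram_of_ne Ψ Φ (by rw [keyOf_append]; simpa using h), keyBlock]

theorem reprogram_keyBlock {ℓ : ℕ → ℕ} {κ m : ℕ} (k : Fin κ → Bool) (Φ Φ' : StateFamily ℓ) :
    reprogram k (keyBlock (m := m) k Φ') Φ = fun x => if keyOf κ m x = some k then Φ' x else Φ x := by
  funext x
  by_cases h : keyOf κ m x = some k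
  · rw [reprogram, dif_pos h, if_pos h, keyBlock, PureState.cast_trans]
    exact StateFamily.cast_apply Φ' (eq_append_of_keyOf h).2.symm _
  · rw [reprogram_of_ne _ _ h, if_neg h]

/-- Fresh Haar states are distributed as the block of an independent copy of `Φ`. Inserting that
block is a coordinatewise mixture of the two copies. -/
theorem measurePreserving_reprogram (ℓ : ℕ → ℕ) {κ m : ℕ} (k : Fin κ → Bool) :
    MeasurePreserving (fun p : StateFamily ℓ × ((Fin m → Bool) → PureState (ℓ (κ + m))) =>
      reprogram k p.2 p.1) ((chfsMeasure ℓ).prod (Measure.pi fun _ => haarState (ℓ (κ + m))))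
      (chfsMeasure ℓ) := by
  have hm : Measurable (fun p : StateFamily ℓ × ((Fin m → Bool) → PureState (ℓ (κ + m))) =>
      reprogram k p.2 p.1) := by
    refine measurable_pi_lambda _ fun x => ?_
    unfold reprogram
    split_ifs
    · exact (PureState.measurePreserving_cast _).measurable.comp
        ((measurable_pi_apply _).comp measurable_snd)
    · exact (measurable_pi_apply _).comp measurable_fst
  have h1 : MeasurePreserving (Prod.map id (keyBlock (ℓ := ℓ) (m := m) k))
      ((chfsMeasure ℓ).prod (chfsMeasure ℓ))
      ((chfsMeasure ℓ).prod (Measure.pi fun _ => haarState (ℓ (κ + m)))) :=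
    (MeasurePreserving.id _).prod (measurePreserving_keyBlock ℓ k)
  have h2 := measurePreserving_mix (fun x : List Bool => haarState (ℓ x.length))
    fun x => keyOf κ m x = some k
  refine ⟨hm, ?_⟩
  rw [← h1.map_eq, Measure.map_map hm h1.measurable]
  have h3 : (fun p : StateFamily ℓ × ((Fin m → Bool) → PureState (ℓ (κ + m))) =>
      reprogram k p.2 p.1) ∘ Prod.map id (keyBlock k) =
      fun q x => if keyOf κ m x = some k then q.2 x else q.1 x :=
    funext fun p => reprogram_keyBlock k p.1 p.2
  rw [h3]
  exact h2.map_eq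

/-! ### Averaging over keys -/

/-- If resampling the `k`-th component of `ω`, for a random `k`, changes `g ω` only a little, then
the average over `k` of `g ω (π k ω)` is close in mean square to the value of `g ω` at an
independent point. -/
theorem integral_sq_average_sub_le {Ω Y K : Type*} [MeasurableSpace Ω] [MeasurableSpace Y] [Fintype K]
    [Nonempty K] [DecidableEq K] (μ : Measure Ω) [IsProbabilityMeasure μ] (ν : Measure Y)
    [IsProbabilityMeasure ν] {π : K → Ω → Y} {T : K → Y → Ω → Ω} {g : Ω → Y → ℝ}
    (hg : Measurable (Function.uncurry g)) (h0 : ∀ ω y, 0 ≤ g ω y) (h1 : ∀ ω y, g ω y ≤ 1)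
    (hπ : ∀ k, Measurable (π k))
    (hT : ∀ k, MeasurePreserving (fun p : Ω × Y => T k p.2 p.1) (μ.prod ν) μ)
    (hπT : ∀ k y ω, π k (T k y ω) = y) (hπT' : ∀ k k' y ω, k' ≠ k → π k' (T k y ω) = π k' ω)
    {δ : ℝ} (hδ : ∀ ω y y', ∑ k, |g (T k y ω) y' - g ω y'| ≤ δ * Fintype.card K) :
    ∫ ω, ((∑ k, g ω (π k ω)) / Fintype.card K - ∫ y, g ω y ∂ν) ^ 2 ∂μ ≤
      4 * δ + 1 / Fintype.card K := by
  set N : ℝ := (Fintype.card K : ℝ) with hN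
  have hN0 : 0 < N := by rw [hN]; exact_mod_cast Fintype.card_pos
  set I : Ω → ℝ := fun ω => ∫ y, g ω y ∂ν with hI
  have hgint : ∀ ω, Integrable (g ω) ν := fun ω =>
    Integrable.of_bound (hg.comp measurable_prodMk_left).aestronglyMeasurable 1
      (.of_forall fun y => by rw [Real.norm_eq_abs, abs_of_nonneg (h0 _ _)]; exact h1 _ _)
  have hIm : Measurable I := (hg.stronglyMeasurable.integral_prod_right (ν := ν)).measurable
  have hI0 : ∀ ω, 0 ≤ I ω := fun ω => integral_nonneg (h0 ω)
  have hI1 : ∀ ω, I ω ≤ 1 := fun ω => by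
    simpa using integral_mono (hgint ω) (integrable_const (1 : ℝ)) (h1 ω)
  set u : K → Ω → ℝ := fun k ω => g ω (π k ω) - I ω with hu
  set D : Ω → ℝ := fun ω => (∑ k, g ω (π k ω)) / N - I ω with hD
  set v : Ω × Y → ℝ := fun p => g p.1 p.2 - I p.1 with hv
  have hum : ∀ k, Measurable (u k) := fun k => (hg.comp (measurable_id.prodMk (hπ k))).sub hIm
  have hDm : Measurable D := ((Finset.measurable_sum _ fun k _ =>
    hg.comp (measurable_id.prodMk (hπ k))).div_const N).sub hIm
  have hvm : Measurable v := hg.sub (hIm.comp measurable_fst)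
  have hDu : ∀ ω, D ω = (∑ k, u k ω) / N := by
    intro ω
    simp only [hD, hu, Finset.sum_sub_distrib, Finset.sum_const, Finset.card_univ, nsmul_eq_mul,
      ← hN]
    field_simp
  have hu1 : ∀ k ω, |u k ω| ≤ 1 := fun k ω =>
    abs_sub_le_of_nonneg_of_le (h0 _ _) (h1 _ _) (hI0 _) (hI1 _)
  have hv1 : ∀ p, |v p| ≤ 1 := fun p =>
    abs_sub_le_of_nonneg_of_le (h0 _ _) (h1 _ _) (hI0 _) (hI1 _)
  have hD1 : ∀ ω, |D ω| ≤ 1 := by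
    intro ω
    rw [hDu, abs_div, abs_of_pos hN0, div_le_one hN0]
    refine (Finset.abs_sum_le_sum_abs _ _).trans ((Finset.sum_le_sum fun k _ => hu1 k ω).trans_eq ?_)
    simp [hN]
  have hmul : ∀ {a b : ℝ}, |a| ≤ 1 → |b| ≤ 1 → |a * b| ≤ 1 := fun ha hb => by
    rw [abs_mul]; exact mul_le_one₀ ha (abs_nonneg _) hb
  have hint1 : ∀ k, Integrable (fun ω => u k ω * D ω) μ := fun k =>
    Integrable.of_bound ((hum k).mul hDm).aestronglyMeasurable 1
      (.of_forall fun ω => hmul (hu1 k ω) (hD1 ω))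
  have hint2 : ∀ k, Integrable (fun p : Ω × Y => u k (T k p.2 p.1) * D (T k p.2 p.1)) (μ.prod ν) :=
    fun k => (hT k).integrable_comp_of_integrable (hint1 k)
  have hint3 : Integrable (fun p : Ω × Y => v p * D p.1) (μ.prod ν) :=
    Integrable.of_bound (hvm.mul (hDm.comp measurable_fst)).aestronglyMeasurable 1
      (.of_forall fun p => hmul (hv1 p) (hD1 p.1))
  have hresample : ∀ k, ∫ ω, u k ω * D ω ∂μ =
      ∫ p : Ω × Y, u k (T k p.2 p.1) * D (T k p.2 p.1) ∂(μ.prod ν) := by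
    intro k
    conv_lhs => rw [← (hT k).map_eq]
    exact integral_map (hT k).measurable.aemeasurable
      ((hum k).mul hDm).aestronglyMeasurable
  -- Given `ω`, the factor `D ω` is constant and `v (ω, ·)` has mean zero.
  have hzero : ∫ p, v p * D p.1 ∂(μ.prod ν) = 0 := by
    rw [integral_prod _ hint3]
    refine integral_eq_zero_of_ae (.of_forall fun ω => ?_)
    simp only [hv, integral_mul_const]
    rw [integral_sub (hgint ω) (integrable_const _)]
    simp [hI]
  have hIT : ∀ ω y, ∑ k, |I (T k y ω) - I ω| ≤ δ * N := by
    intro ω y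
    have hi : ∀ k, Integrable (fun y' => |g (T k y ω) y' - g ω y'|) ν := fun k =>
      ((hgint _).sub (hgint _)).abs
    calc ∑ k, |I (T k y ω) - I ω| ≤ ∑ k, ∫ y', |g (T k y ω) y' - g ω y'| ∂ν := by
          refine Finset.sum_le_sum fun k _ => ?_
          simp only [hI]
          rw [← integral_sub (hgint _) (hgint _)]
          exact abs_integral_le_integral_abs
      _ = ∫ y', ∑ k, |g (T k y ω) y' - g ω y'| ∂ν := (integral_finsetSum _ fun k _ => hi k).symm
      _ ≤ ∫ _, δ * N ∂ν := integral_mono (integrable_finsetSum _ fun k _ => hi k)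
          (integrable_const _) fun y' => hδ ω y y'
      _ = δ * N := by simp
  have huT : ∀ ω y, ∑ k, |u k (T k y ω) - v (ω, y)| ≤ 2 * (δ * N) := by
    intro ω y
    calc ∑ k, |u k (T k y ω) - v (ω, y)|
        ≤ ∑ k, (|g (T k y ω) y - g ω y| + |I (T k y ω) - I ω|) := by
          refine Finset.sum_le_sum fun k _ => ?_
          simp only [hu, hv, hπT]
          rw [sub_sub_sub_comm]
          exact abs_sub _ _
      _ ≤ 2 * (δ * N) := by
          rw [Finset.sum_add_distrib, two_mul]
          exact add_le_add (hδ ω y y) (hIT ω y)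
  -- Resampling component `k` changes the second argument of `g` only in the summand `k' = k`. That
  -- summand contributes at most `1 / N` for each `k`, hence the `+ 1` after summing over `k`.
  have hDT : ∀ ω y, ∑ k, |D (T k y ω) - D ω| ≤ 2 * (δ * N) + 1 := by
    intro ω y
    have hk : ∀ k, |D (T k y ω) - D ω| ≤
        (∑ k', (|g (T k y ω) (π k' ω) - g ω (π k' ω)| + if k' = k then 1 else 0)) / N +
          |I (T k y ω) - I ω| := by
      intro k
      simp only [hD]
      rw [sub_sub_sub_comm, ← sub_div, ← Finset.sum_sub_distrib]
      refine (abs_sub _ _).trans ?_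
      gcongr
      rw [abs_div, abs_of_pos hN0]
      gcongr
      refine (Finset.abs_sum_le_sum_abs _ _).trans (Finset.sum_le_sum fun k' _ => ?_)
      by_cases hkk : k' = k
      · rw [if_pos hkk]
        have := abs_sub_le_of_nonneg_of_le (h0 (T k y ω) (π k' (T k y ω))) (h1 _ _)
          (h0 ω (π k' ω)) (h1 _ _)
        linarith [abs_nonneg (g (T k y ω) (π k' ω) - g ω (π k' ω))]
      · rw [if_neg hkk, hπT' k k' y ω hkk, add_zero]
    calc ∑ k, |D (T k y ω) - D ω| ≤ _ := Finset.sum_le_sum fun k _ => hk k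
      _ = (∑ k', ∑ k, |g (T k y ω) (π k' ω) - g ω (π k' ω)| + N) / N +
          ∑ k, |I (T k y ω) - I ω| := by
        rw [Finset.sum_add_distrib, ← Finset.sum_div]
        simp only [Finset.sum_add_distrib]
        rw [Finset.sum_comm]
        simp [hN]
      _ ≤ (∑ _k' : K, δ * N + N) / N + δ * N := by
        gcongr with k'
        · exact hδ ω y (π k' ω)
        · exact hIT ω y
      _ = 2 * (δ * N) + 1 := by
        simp only [Finset.sum_const, Finset.card_univ, nsmul_eq_mul, ← hN]
        field_simp
        ring
  -- Both factors are at most one in absolute value, so the error of the product is at most the sum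
  -- of the errors in `huT` and `hDT`, divided by `N`.
  have hpt : ∀ p : Ω × Y, (∑ k, u k (T k p.2 p.1) * D (T k p.2 p.1)) / N - v p * D p.1 ≤
      4 * δ + 1 / N := by
    rintro ⟨ω, y⟩
    have h2 : (∑ k, u k (T k y ω) * D (T k y ω)) / N - v (ω, y) * D ω =
        (∑ k, (u k (T k y ω) * D (T k y ω) - v (ω, y) * D ω)) / N := by
      simp only [Finset.sum_sub_distrib, Finset.sum_const, Finset.card_univ, nsmul_eq_mul, ← hN]
      field_simp
    have h3 : ∀ k, u k (T k y ω) * D (T k y ω) - v (ω, y) * D ω ≤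
        |u k (T k y ω) - v (ω, y)| + |D (T k y ω) - D ω| := by
      intro k
      calc u k (T k y ω) * D (T k y ω) - v (ω, y) * D ω
          = (u k (T k y ω) - v (ω, y)) * D (T k y ω) + v (ω, y) * (D (T k y ω) - D ω) := by ring
        _ ≤ |(u k (T k y ω) - v (ω, y)) * D (T k y ω)| + |v (ω, y) * (D (T k y ω) - D ω)| :=
          add_le_add (le_abs_self _) (le_abs_self _)
        _ ≤ _ := by
          rw [abs_mul, abs_mul]
          exact add_le_add (mul_le_of_le_one_right (abs_nonneg _) (hD1 _))
            (mul_le_of_le_one_left (abs_nonneg _) (hv1 _))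
    simp only
    rw [h2, div_le_iff₀ hN0]
    calc _ ≤ ∑ k, (|u k (T k y ω) - v (ω, y)| + |D (T k y ω) - D ω|) :=
          Finset.sum_le_sum fun k _ => h3 k
      _ ≤ 2 * (δ * N) + (2 * (δ * N) + 1) := by
          rw [Finset.sum_add_distrib]
          exact add_le_add (huT ω y) (hDT ω y)
      _ = _ := by field_simp; ring
  have hsum : Integrable (fun p : Ω × Y => (∑ k, u k (T k p.2 p.1) * D (T k p.2 p.1)) / N)
      (μ.prod ν) := (integrable_finsetSum _ fun k _ => hint2 k).div_const N
  calc ∫ ω, D ω ^ 2 ∂μ = ∫ ω, (∑ k, u k ω * D ω) / N ∂μ := by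
        congr 1
        funext ω
        rw [← Finset.sum_mul, sq, mul_div_right_comm, ← hDu]
    _ = (∑ k, ∫ ω, u k ω * D ω ∂μ) / N := by
        rw [integral_div, integral_finsetSum _ fun k _ => hint1 k]
    _ = ∫ p : Ω × Y, ((∑ k, u k (T k p.2 p.1) * D (T k p.2 p.1)) / N - v p * D p.1)
          ∂(μ.prod ν) := by
        rw [integral_sub hsum hint3, hzero, sub_zero, integral_div,
          integral_finsetSum _ fun k _ => hint2 k]
        simp only [hresample]
    _ ≤ ∫ _, (4 * δ + 1 / N) ∂(μ.prod ν) :=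
        integral_mono (hsum.sub hint3) (integrable_const _) hpt
    _ = 4 * δ + 1 / N := by simp

/-! ### Almost sure security -/

/-- For each exponent `c` the expectations of `(s^c X_s)²` are summable, so almost surely the series
itself converges and its terms tend to zero. The exponents are countable. -/
theorem ae_superpolynomialDecay {Ω : Type*} [MeasurableSpace Ω] {μ : Measure Ω} {X : ℕ → Ω → ℝ}
    (hX : ∀ s, Measurable (X s)) (hint : ∀ s, Integrable (fun ω => X s ω ^ 2) μ) {W : ℕ → ℝ}
    (hW : Negligible W) (h : ∀ s, ∫ ω, X s ω ^ 2 ∂μ ≤ W s) :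
    ∀ᵐ ω ∂μ, Negligible fun s => X s ω := by
  have key : ∀ c : ℕ, ∀ᵐ ω ∂μ, Tendsto (fun s : ℕ => (s : ℝ) ^ c * X s ω) atTop (nhds 0) := by
    intro c
    have hW0 : ∀ s, 0 ≤ W s := fun s => (integral_nonneg fun ω => sq_nonneg _).trans (h s)
    have hsum : Summable fun s : ℕ => (s : ℝ) ^ (2 * c) * W s := by
      refine summable_of_isBigO_nat (Real.summable_one_div_nat_pow.2 one_lt_two) ?_
      -- Two extra powers of `s` leave the summable majorant `1 / s²`.
      have h1 : (fun s : ℕ => (s : ℝ) ^ (2 * c + 2) * W s) =O[atTop] fun _ => (1 : ℝ) :=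
        (hW (2 * c + 2)).isBigO_one ℝ
      have h2 := h1.mul (isBigO_refl (fun s : ℕ => 1 / (s : ℝ) ^ 2) atTop)
      simp only [one_mul] at h2
      refine (EventuallyEq.isBigO ?_).trans h2
      filter_upwards [eventually_gt_atTop 0] with s hs
      have : (s : ℝ) ≠ 0 := by positivity
      field_simp
      ring
    have hle : ∀ s : ℕ, ∫⁻ ω, ENNReal.ofReal (((s : ℝ) ^ c * X s ω) ^ 2) ∂μ ≤
        ENNReal.ofReal ((s : ℝ) ^ (2 * c) * W s) := by
      intro s
      simp only [mul_pow, ← pow_mul]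
      rw [← ofReal_integral_eq_lintegral_ofReal ((hint s).const_mul _)
        (.of_forall fun ω => by positivity), integral_const_mul, mul_comm c 2]
      gcongr
      exact h s
    have hfin : ∫⁻ ω, ∑' s : ℕ, ENNReal.ofReal (((s : ℝ) ^ c * X s ω) ^ 2) ∂μ ≠ ⊤ := by
      rw [lintegral_tsum fun s =>
        (((hX s).const_mul _).pow_const 2).ennreal_ofReal.aemeasurable]
      exact ne_top_of_le_ne_top hsum.tsum_ofReal_ne_top (ENNReal.tsum_le_tsum hle)
    have hmeas : AEMeasurable (fun ω => ∑' s : ℕ, ENNReal.ofReal (((s : ℝ) ^ c * X s ω) ^ 2)) μ :=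
      (Measurable.tsum fun s =>
        (((hX s).const_mul _).pow_const 2).ennreal_ofReal).aemeasurable
    filter_upwards [ae_lt_top' hmeas hfin] with ω hω
    have h1 := ENNReal.tendsto_atTop_zero_of_tsum_ne_top hω.ne
    have h2 := (ENNReal.tendsto_toReal ENNReal.zero_ne_top).comp h1
    have h3 : Tendsto (fun s : ℕ => ((s : ℝ) ^ c * X s ω) ^ 2) atTop (nhds 0) := by
      refine h2.congr fun s => ?_
      simp only [Function.comp_apply]
      rw [ENNReal.toReal_ofReal (sq_nonneg _)]
    have h4 := h3.sqrt
    simp only [Real.sqrt_sq_eq_abs, Real.sqrt_zero] at h4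
    exact (tendsto_zero_iff_abs_tendsto_zero _).2 h4
  filter_upwards [ae_all_iff.2 key] with ω hω c using hω c

/-! ### Negligible bounds and the second moment of the advantage -/

theorem negligible_inv_sqrt_two_pow {κ : ℕ → ℕ}
    (hκ : (fun s : ℕ => Real.log s) =o[atTop] fun s : ℕ => (κ s : ℝ)) :
    Negligible fun s => (√(2 ^ κ s))⁻¹ := by
  intro c
  have hlog : 0 < Real.log 2 := Real.log_pos one_lt_two
  -- With this constant, `(c + 1) log s ≤ (κ/2) log 2`, that is, `s^(c+1) ≤ √(2^κ)`; the spare power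
  -- of `s` gives convergence to zero.
  have hc : 0 < Real.log 2 / (2 * (c + 1)) := by positivity
  have h1 : ∀ᶠ s : ℕ in atTop, (s : ℝ) ^ c * (√(2 ^ κ s))⁻¹ ≤ 1 / (s : ℝ) := by
    filter_upwards [hκ.bound hc, eventually_gt_atTop 0] with s hs hs0
    have hs1 : (0 : ℝ) < s := by exact_mod_cast hs0
    rw [Real.norm_natCast, Real.norm_eq_abs] at hs
    have h2 : Real.log ((s : ℝ) ^ (c + 1)) ≤ Real.log √(2 ^ κ s) := by
      rw [Real.log_sqrt (by positivity), Real.log_pow, Real.log_pow]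
      have h3 := (le_abs_self _).trans hs
      rw [div_mul_eq_mul_div, le_div_iff₀ (by positivity)] at h3
      push_cast
      linarith
    have h3 := (Real.log_le_log_iff (by positivity) (by positivity)).1 h2
    rw [← div_eq_mul_inv, div_le_div_iff₀ (by positivity) hs1, one_mul, ← pow_succ]
    exact h3
  refine squeeze_zero' (.of_forall fun s => by positivity) h1 ?_
  exact tendsto_one_div_atTop_nhds_zero_nat

theorem Negligible.polyBounded_mul {f : ℕ → ℕ} {ε : ℕ → ℝ} (hf : PolyBounded f) (hε : Negligible ε)
    (hε0 : ∀ s, 0 ≤ ε s) : Negligible fun s => (f s : ℝ) * ε s := by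
  obtain ⟨p, hp⟩ := hf
  have h := SuperpolynomialDecay.polynomial_mul hε (p.map (Nat.castRingHom ℝ))
  refine SuperpolynomialDecay.trans_eventually_abs_le h (.of_forall fun s => ?_)
  have hps : (p.map (Nat.castRingHom ℝ)).eval (s : ℝ) = (p.eval s : ℕ) := by
    rw [Polynomial.eval_natCast_map]; rfl
  simp only [Function.comp_apply, hps]
  rw [abs_of_nonneg (mul_nonneg (Nat.cast_nonneg _) (hε0 s)),
    abs_of_nonneg (mul_nonneg (Nat.cast_nonneg _) (hε0 s))]
  gcongr
  · exact hε0 s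
  · exact hp s

theorem measurable_integral_haarAccept {ℓ : ℕ → ℕ} (S : Setting) (m n : ℕ) (A : Circuit) :
    Measurable fun Φ : StateFamily ℓ =>
      ∫ Ψ, haarAccept S m n A Φ Ψ ∂(Measure.pi fun _ : Fin m → Bool => haarState n) :=
  ((measurable_haarAccept S m n A).stronglyMeasurable.integral_prod_right).measurable

/-- The advantage of the circuit `A` against the generator. -/
def advantage {ℓ : ℕ → ℕ} (S : Setting) (c κ m : ℕ) (A : Circuit) (Φ : StateFamily ℓ) : ℝ :=
  realProb S Φ κ m (ℓ (κ + m)) (prfsGen S.model c (ℓ (κ + m)) κ m) A -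
    idealProb S Φ m (ℓ (κ + m)) A

theorem advantage_eq {ℓ : ℕ → ℕ} (S : Setting) (c κ m : ℕ) (A : Circuit) (Φ : StateFamily ℓ) :
    advantage S c κ m A Φ = (∑ k : Fin κ → Bool, haarAccept S m (ℓ (κ + m)) A Φ (keyBlock k Φ)) /
      (Fintype.card (Fin κ → Bool) : ℝ) - ∫ Ψ, haarAccept S m (ℓ (κ + m)) A Φ Ψ
        ∂(Measure.pi fun _ : Fin m → Bool => haarState (ℓ (κ + m))) := by
  rw [advantage, realProb_prfsGen]
  simp only [Fintype.card_fun, Fintype.card_bool, Fintype.card_fin, Nat.cast_pow, Nat.cast_ofNat]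
  rfl

theorem measurable_advantage {ℓ : ℕ → ℕ} (S : Setting) (c κ m : ℕ) (A : Circuit) :
    Measurable (advantage (ℓ := ℓ) S c κ m A) := by
  rw [funext (advantage_eq S c κ m A)]
  exact ((Finset.measurable_sum _ fun k _ => (measurable_haarAccept S m _ A).comp
    (measurable_id.prodMk (measurePreserving_keyBlock ℓ k).measurable)).div_const _).sub
    (measurable_integral_haarAccept S m _ A)

theorem integral_advantage_sq_le {ℓ : ℕ → ℕ} (S : Setting) (c κ m : ℕ) (A : Circuit) :
    ∫ Φ, advantage S c κ m A Φ ^ 2 ∂(chfsMeasure ℓ) ≤ (16 * A.length + 1 : ℕ) * (√(2 ^ κ))⁻¹ := by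
  have hcard : (Fintype.card (Fin κ → Bool) : ℝ) = 2 ^ κ := by simp
  have hsq : √((2 : ℝ) ^ κ) * √(2 ^ κ) = 2 ^ κ := Real.mul_self_sqrt (by positivity)
  have hpos : 0 < √((2 : ℝ) ^ κ) := by positivity
  have h := integral_sq_average_sub_le (chfsMeasure ℓ)
    (Measure.pi fun _ : Fin m → Bool => haarState (ℓ (κ + m))) (π := fun k => keyBlock k)
    (T := fun k => reprogram k) (g := haarAccept S m (ℓ (κ + m)) A)
    (measurable_haarAccept S m _ A) (haarAccept_nonneg S m _ A) (haarAccept_le_one S m _ A)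
    (fun k => (measurePreserving_keyBlock ℓ k).measurable) (measurePreserving_reprogram ℓ)
    (fun k Ψ Φ => keyBlock_reprogram k Ψ Φ)
    -- The hybrid bound `4 |A| √(2^κ)` equals `δ · 2^κ` for this `δ`. The factor 16 in the
    -- conclusion is `4 · 4`, and the `+ 1` absorbs `1 / 2^κ`.
    (fun k k' Ψ Φ hk => keyBlock_reprogram_of_ne hk Ψ Φ) (δ := 4 * A.length * (√(2 ^ κ))⁻¹)
    (fun Φ Ψ Ψ' => by
      refine (sum_abs_haarAccept_sub_le S m _ A Ψ' Φ (fun k => reprogram k Ψ Φ) (keyOf κ m)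
        fun k x hx => reprogram_of_ne Ψ Φ hx).trans_eq ?_
      rw [hcard]
      nth_rewrite 3 [← hsq]
      field_simp)
  simp only [← advantage_eq S c κ m A] at h
  refine h.trans ?_
  rw [hcard]
  have h1 : 1 / (2 : ℝ) ^ κ ≤ (√(2 ^ κ))⁻¹ := by
    rw [one_div]
    refine inv_anti₀ hpos ?_
    rw [Real.sqrt_le_left (by positivity)]
    exact le_self_pow₀ (one_le_pow₀ one_le_two) two_ne_zero
  push_cast
  linarith

theorem ae_negligible_advantage {ℓ κ m : ℕ → ℕ} (hℓ : PolyBounded ℓ) (hκ : PolyBounded κ)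
    (hm : PolyBounded m) (hκ_log : (fun s : ℕ => Real.log s) =o[atTop] fun s : ℕ => (κ s : ℝ))
    (S : Setting) {A : ℕ → Circuit} (hA : IsQPT (fun s => ℓ (κ s + m s)) κ m A) :
    ∀ᵐ Φ ∂chfsMeasure ℓ, Negligible fun s => advantage S s (κ s) (m s) (A s) Φ := by
  have hlen : PolyBounded fun s => 16 * (A s).length + 1 := by
    obtain ⟨p, hp⟩ := hA.length_polyBounded (hℓ.comp_add hκ hm) hκ hm
    refine ⟨16 * p + 1, fun s => ?_⟩
    have := hp s
    simp
    omega
  refine ae_superpolynomialDecay (fun s => measurable_advantage S s (κ s) (m s) (A s)) (fun s => ?_)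
    (Negligible.polyBounded_mul hlen (negligible_inv_sqrt_two_pow hκ_log) fun s => by positivity)
    fun s => integral_advantage_sq_le S s (κ s) (m s) (A s)
  refine Integrable.of_bound ((measurable_advantage S s _ _ _).pow_const 2).aestronglyMeasurable 1
    (.of_forall fun Φ => ?_)
  have h0 := haarAccept_nonneg S (m s) (ℓ (κ s + m s)) (A s) Φ
  have h1 := haarAccept_le_one S (m s) (ℓ (κ s + m s)) (A s) Φ
  have hI0 : 0 ≤ ∫ Ψ, haarAccept S (m s) (ℓ (κ s + m s)) (A s) Φ Ψ ∂(Measure.pi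
    fun _ : Fin (m s) → Bool => haarState (ℓ (κ s + m s))) := integral_nonneg h0
  have hI1 : ∫ Ψ, haarAccept S (m s) (ℓ (κ s + m s)) (A s) Φ Ψ ∂(Measure.pi
      fun _ : Fin (m s) → Bool => haarState (ℓ (κ s + m s))) ≤ ∫ _, (1 : ℝ) ∂(Measure.pi
      fun _ : Fin (m s) → Bool => haarState (ℓ (κ s + m s))) :=
    integral_mono_of_nonneg (.of_forall h0) (integrable_const (1 : ℝ)) (.of_forall h1)
  simp only [integral_const, probReal_univ, smul_eq_mul, mul_one] at hI1
  have habs : |advantage S s (κ s) (m s) (A s) Φ| ≤ 1 := by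
    rw [advantage_eq]
    refine abs_sub_le_of_nonneg_of_le
      (div_nonneg (Finset.sum_nonneg fun k _ => h0 _) (Nat.cast_nonneg _)) ?_ hI0 hI1
    refine div_le_one_of_le₀ ((Finset.sum_le_sum fun k _ => h1 _).trans_eq ?_) (Nat.cast_nonneg _)
    simp
  rw [Real.norm_eq_abs, abs_pow]
  exact pow_le_one₀ (abs_nonneg _) habs

end CHFS

end

theorem mainTheorem5 (ℓ κ m : ℕ → ℕ)
    (hℓ : CHFS.PolyBounded ℓ) (hκ : CHFS.PolyBounded κ) (hm : CHFS.PolyBounded m)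
    (hκ_log : (fun s : ℕ => Real.log s) =o[atTop] fun s : ℕ => (κ s : ℝ))
    (S : CHFS.Setting) :
    ∃ Gen : ℕ → CHFS.Circuit, ∀ᵐ Φ ∂CHFS.chfsMeasure ℓ,
      CHFS.IsPRFSG S Φ κ m (fun s => ℓ (κ s + m s)) Gen := by
  refine ⟨fun s => CHFS.prfsGen S.model s (ℓ (κ s + m s)) (κ s) (m s), ?_⟩
  -- The exceptional null set of `Φ` depends on the adversary; countability of the adversaries
  -- allows a single one for all of them.
  filter_upwards [(ae_ball_iff (CHFS.countable_setOf_isQPT (fun s => ℓ (κ s + m s)) κ m)).2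
    fun A hA => CHFS.ae_negligible_advantage hℓ hκ hm hκ_log S hA] with Φ hΦ
  exact {
    isQPT := CHFS.prfsGen_isQPT S.model (hℓ.comp_add hκ hm) hκ hm
    stateGeneration := fun s => CHFS.generatesStates_prfsGen S Φ s (κ s) (m s)
    pseudorandomness := fun A hA =>
      ⟨fun s => |CHFS.advantage S s (κ s) (m s) (A s) Φ|,
        SuperpolynomialDecay.trans_abs_le (hΦ A hA) fun s => (abs_abs _).le, fun s => le_rfl⟩ }
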